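/- Let $m \ge 3$ and $1 \le j < m$ be integers with $\gcd(m,j)=1$, let $\lambda>0$ be the unique positive real number with $\lambda^{2m}=\lambda^{2j}+1$ (so $\lambda>1$), and identify the plane with $\mathbb{C}$. Tiles and substitutions. Put $a=\lambda^{-m}$, $b=\sqrt{1-a^2}=\lambda^{j-m}$, $\theta=\arccos a$. Let $T_1$ be the right triangle with vertices $0,\,-a,\,-a+ib$, and let $T_{i+1}=\lambda^{i}T_1$ for $1\le i\le m-1$. A tile is a congruent copy $g(T_i)$ of one of these prototiles, where $g(z)=e^{i\alpha}z+t$ or $g(z)=e^{i\alpha}\bar z+t$; its angle is $\alpha(g(T_i))=\alpha\in[0,2\pi)$. A substitution $\sigma$ with factor $c$ assigns to each prototile $T_i$ a set $\sigma(T_i)$ of tiles filling $cT_i$; it is extended to sets of tiles by $\sigma(g(T_i))=g_c(\sigma(T_i))$, where $g_c(z)=c\,g(z/c)$. The Pythagoras substitution $\sigma_{m,j}$ has factor $\lambda$ and is given by $\sigma_{m,j}(T_i)=\{T_{i+1}\}$ for $i<m$ and $\sigma_{m,j}(T_m)=\{\varphi(T_1),\psi(T_{j+1})\}$, with $\varphi(z)=e^{-i\theta}\bar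 z$ and $\psi(z)=e^{-i(\theta+\pi/2)}\bar z-1$ (the dissection of $\lambda T_m$ by the altitude on its hypotenuse). The patch $\sigma_{m,j}^{2m}(T_1)$ contains two tiles of type $T_{j+1}$ that form the rectangle with vertices $-\lambda^m,\,-a,\,-a+ib,\,-\lambda^m+ib$ and are separated by its diagonal from $-\lambda^m$ to $-a+ib$. The Pythia substitution $\rho=\rho_{m,j}$, with factor $\lambda^{2m}$, is defined as follows: $\rho(T_1)$ is $\sigma_{m,j}^{2m}(T_1)$ with these two tiles replaced by the two tiles of type $T_{j+1}$ into which the other diagonal dissects the rectangle, and $\rho(T_i)=\sigma_{m,j}^{\,i-1}(\rho(T_1))$ for $2\le i\le m$. A substitution tiling for $\rho$ is a set $\mathcal T$ of tiles that covers the plane, whose tiles have pairwise disjoint interiors, and each of whose finite subsets is congruent to a subset of $\rho^k(T_i)$ for some $k,i$. A supertile is a set of tiles congruent to $\rho^k(T_i)$ for some $k,i$. Theorem. Every substitution tiling $\mathcal T$ for $\rho_{m,j}$ has statistical circular symmetry. That is, $\rho_{m,j}$ is primitive (some power of the matrix whose entry $(i,k)$ is the number of tiles of type $T_k$ in $\rho(T_i)$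 has only positive entries), and for all $0\le x<y<2\pi$: 1. if $t_1,t_2,\dots$ is an enumeration of $\mathcal T$ without repetition such that $\{t_1,\dots,t_\ell\}$ is a supertile for infinitely many $\ell$, then $\frac1\ell\,\#\{k\le \ell : \alpha(t_k)\in[x,y]\}\to\frac{y-x}{2\pi}$ as $\ell\to\infty$ through these $\ell$; 2. with $\mathcal T_r$ the set of tiles of $\mathcal T$ that meet the closed ball of radius $r$ about the origin, $\#\{t\in\mathcal T_r : \alpha(t)\in[x,y]\}\,/\,\#\mathcal T_r\to\frac{y-x}{2\pi}$ as $r\to\infty$. -/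

import Mathlib

open Set Filter Topology

noncomputable section

namespace SubstTiling

/-- Congruences of the plane, which is identified with `ℂ`; reflections are allowed. -/
abbrev Motion : Type := ℂ ≃ᵃⁱ[ℝ] ℂ

/-- The motion `z ↦ exp (i φ) * z + t`. -/
def rot (φ : ℝ) (t : ℂ) : Motion :=
  (rotation (Circle.exp φ)).toAffineIsometryEquiv.trans (AffineIsometryEquiv.constVAdd ℝ ℂ t)

/-- The motion `z ↦ exp (i φ) * conj z + t`. -/
def mirror (φ : ℝ) (t : ℂ) : Motion :=
  (Complex.conjLIE.trans (rotation (Circle.exp φ))).toAffineIsometryEquiv.trans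
    (AffineIsometryEquiv.constVAdd ℝ ℂ t)

/-- The motion with the same linear part as `g` and with translation part scaled by `c`;
this is `z ↦ c * g (z / c)` if `c ≠ 0`. -/
def dilate (c : ℝ) (g : Motion) : Motion :=
  g.linearIsometryEquiv.toAffineIsometryEquiv.trans
    (AffineIsometryEquiv.constVAdd ℝ ℂ (c • g 0))

theorem rot_apply (φ : ℝ) (t z : ℂ) : rot φ t z = Complex.exp (φ * Complex.I) * z + t := by
  simp [rot, add_comm]

theorem mirror_apply (φ : ℝ) (t z : ℂ) :
    mirror φ t z = Complex.exp (φ * Complex.I) * (starRingEnd ℂ) z + t := by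
  simp [mirror, add_comm]

theorem dilate_apply (c : ℝ) (g : Motion) (z : ℂ) :
    dilate c g z = g.linearIsometryEquiv z + c * g 0 := by
  simp [dilate, add_comm]

/-- A tile is a congruent copy of a prototile: the pair `(i, g)` stands for the image of the
prototile with index `i` under the motion `g`. -/
abbrev Tile (n : ℕ) : Type := Fin n × Motion

/-- The copy of a tile under a motion. -/
def Tile.move {n : ℕ} (g : Motion) (T : Tile n) : Tile n := (T.1, g * T.2)

/-- The angle `α(T) ∈ [0, 2π)` of a tile: `α` for the tile `z ↦ exp (i α) * z + t` applied to a
prototile, and for the tile `z ↦ exp (i α) * conj z + t` applied to a prototile. In both cases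
`exp (i α)` is the image of `1` under the linear part. -/
def Tile.angle {n : ℕ} (T : Tile n) : ℝ :=
  toIcoMod Real.two_pi_pos 0 (Complex.arg (T.2.linearIsometryEquiv 1))

/-- A tile substitution with `n` prototiles `proto i`: the prototile with index `i` is enlarged
by `factor` and replaced by the tiles in `rule i`. -/
structure Substitution (n : ℕ) where
  /-- the substitution factor -/
  factor : ℝ
  /-- the prototiles -/
  proto : Fin n → Set ℂ
  /-- the tiles that replace an enlarged prototile -/
  rule : Fin n → Set (Tile n)

namespace Substitution

variable {n : ℕ} (s : Substitution n)

/-- The subset of the plane that a tile occupies. -/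
def support (T : Tile n) : Set ℂ := T.2 '' s.proto T.1

/-- The substitution acting on a collection of tiles. -/
def apply (P : Set (Tile n)) : Set (Tile n) :=
  ⋃ T ∈ P, Tile.move (dilate s.factor T.2) '' s.rule T.1

/-- The supertile of order `k` of the prototile with index `i`, that is, the `k`-fold iterate
of the substitution on this prototile. -/
def supertile (k : ℕ) (i : Fin n) : Set (Tile n) := s.apply^[k] {(i, 1)}

/-- The substitution matrix: the entry `(i, k)` is the number of tiles of type `k` that replace
the prototile with index `i`. -/
def matrix : Matrix (Fin n) (Fin n) ℝ :=
  Matrix.of fun i k => (({g : Motion | (k, g) ∈ s.rule i}).ncard : ℝ)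

/-- A tiling of the plane: a covering that is also a packing. -/
structure IsTiling (𝒯 : Set (Tile n)) : Prop where
  covers : ⋃ T ∈ 𝒯, s.support T = univ
  packs : 𝒯.Pairwise fun T T' => Disjoint (interior (s.support T)) (interior (s.support T'))

/-- A substitution tiling: a tiling each of whose patches (finite sets of its tiles) is
congruent to a patch in some supertile of a prototile. -/
structure IsSubstitutionTiling (𝒯 : Set (Tile n)) : Prop where
  isTiling : s.IsTiling 𝒯
  patch : ∀ P ⊆ 𝒯, P.Finite →
    ∃ (k : ℕ) (i : Fin n) (g : Motion), Tile.move g '' P ⊆ s.supertile k i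

/-- The set of tiles `P` is congruent to a supertile of a prototile. -/
def IsSupertile (P : Set (Tile n)) : Prop :=
  ∃ (k : ℕ) (i : Fin n) (g : Motion), P = Tile.move g '' s.supertile k i

/-- Statistical circular symmetry of a tiling `𝒯` by tiles of a primitive substitution.

`of_supertiles`: if the tiles of `𝒯` are arranged in a sequence such that arbitrarily long
initial segments are supertiles, then the angles are uniformly distributed in `[0, 2π)` along
these initial segments.

`of_balls`: the angles are uniformly distributed in `[0, 2π)` with respect to the arrangement
of the tiles by distance from the origin, that is, along the sets of all tiles that meet the
closed ball of radius `r` about the origin, as `r → ∞`. -/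
structure HasStatisticalCircularSymmetry (𝒯 : Set (Tile n)) : Prop where
  primitive : s.matrix.IsPrimitive
  of_supertiles : ∀ e : ℕ → Tile n, Function.Injective e → range e = 𝒯 →
    (∀ N : ℕ, ∃ l ≥ N, s.IsSupertile (e '' Iio l)) →
    ∀ x y : ℝ, 0 ≤ x → x < y → y < 2 * Real.pi →
      Tendsto
        (fun l : ℕ => (1 / (l : ℝ)) *
          ∑ k ∈ Finset.range l, (Icc x y).indicator (fun _ => (1 : ℝ)) (e k).angle)
        (atTop ⊓ 𝓟 {l : ℕ | s.IsSupertile (e '' Iio l)})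
        (𝓝 ((y - x) / (2 * Real.pi)))
  of_balls : ∀ x y : ℝ, 0 ≤ x → x < y → y < 2 * Real.pi →
      Tendsto
        (fun r : ℝ =>
          (({T ∈ 𝒯 | (s.support T ∩ Metric.closedBall 0 r).Nonempty ∧
              T.angle ∈ Icc x y}).ncard : ℝ) /
            (({T ∈ 𝒯 | (s.support T ∩ Metric.closedBall 0 r).Nonempty}).ncard : ℝ))
        atTop
        (𝓝 ((y - x) / (2 * Real.pi)))

end Substitution

/-! The Pythagoras and Pythia substitutions. The prototiles `T_1, …, T_m` have the indices
`0, …, m - 1`. -/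

theorem existsUnique_factor {m j : ℕ} (hjm : j < m) :
    ∃! x : ℝ, 0 < x ∧ x ^ (2 * m) = x ^ (2 * j) + 1 := by
  obtain ⟨d, rfl⟩ := Nat.exists_eq_add_of_lt hjm
  have key : ∀ x : ℝ, x ^ (2 * (j + d + 1)) = x ^ (2 * j) * x ^ (2 * (d + 1)) := fun x => by
    rw [← pow_add]; congr 1; ring
  have one_lt : ∀ x : ℝ, 0 < x → x ^ (2 * (j + d + 1)) = x ^ (2 * j) + 1 → 1 < x := by
    intro x hx h
    by_contra hle
    have h1 : x ^ (2 * (j + d + 1)) ≤ 1 := pow_le_one₀ hx.le (not_lt.mp hle)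
    have h2 : 0 < x ^ (2 * j) := by positivity
    linarith
  have mono : ∀ x y : ℝ, 1 < x → x < y →
      x ^ (2 * (j + d + 1)) - x ^ (2 * j) < y ^ (2 * (j + d + 1)) - y ^ (2 * j) := by
    intro x y hx hxy
    have h1 : x ^ (2 * j) ≤ y ^ (2 * j) := by gcongr
    have h2 : x ^ (2 * (d + 1)) < y ^ (2 * (d + 1)) := by gcongr
    have h3 : 1 < x ^ (2 * (d + 1)) := one_lt_pow₀ hx (by omega)
    have h4 : 0 < x ^ (2 * j) := by positivity
    rw [key, key]
    nlinarith
  have hc : ContinuousOn (fun x : ℝ => x ^ (2 * (j + d + 1)) - x ^ (2 * j)) (Icc 1 2) := by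
    fun_prop
  have h2 : (1 : ℝ) ≤ 2 ^ (2 * (j + d + 1)) - 2 ^ (2 * j) := by
    have h3 : (1 : ℝ) ≤ 2 ^ (2 * j) := one_le_pow₀ (by norm_num)
    have h4 : (2 : ℝ) ^ 1 ≤ 2 ^ (2 * (d + 1)) := pow_le_pow_right₀ (by norm_num) (by omega)
    rw [key]
    nlinarith
  obtain ⟨x, hx, hfx⟩ := intermediate_value_Icc (by norm_num : (1 : ℝ) ≤ 2) hc
    ⟨by simp, h2⟩
  have hx0 : 0 < x := lt_of_lt_of_le one_pos hx.1
  have hxe : x ^ (2 * (j + d + 1)) = x ^ (2 * j) + 1 := by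
    simp only at hfx; linarith
  refine ⟨x, ⟨hx0, hxe⟩, ?_⟩
  rintro y ⟨hy0, hye⟩
  have hx1 := one_lt x hx0 hxe
  have hy1 := one_lt y hy0 hye
  rcases lt_trichotomy y x with h | h | h
  · have := mono y x hy1 h; linarith
  · exact h
  · have := mono x y hx1 h; linarith

/-- The factor of the Pythagoras substitution: the positive real number `x` with
`x ^ (2 * m) = x ^ (2 * j) + 1`. -/
def pythagorasFactor {m j : ℕ} (hjm : j < m) : ℝ := (existsUnique_factor hjm).choose

/-- The length `a = lam ^ (-m)` of the short leg of the first prototile. -/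
def shortLeg {m j : ℕ} (hjm : j < m) : ℝ := (pythagorasFactor hjm ^ m)⁻¹

/-- The length `√(1 - a ^ 2)` of the long leg of the first prototile. -/
def longLeg {m j : ℕ} (hjm : j < m) : ℝ := √(1 - shortLeg hjm ^ 2)

/-- The angle between the short leg and the hypotenuse of the prototiles. -/
def theta {m j : ℕ} (hjm : j < m) : ℝ := Real.arccos (shortLeg hjm)

/-- The vertex `-a + i √(1 - a ^ 2)` of the first prototile. -/
def apex {m j : ℕ} (hjm : j < m) : ℂ := -(shortLeg hjm : ℂ) + (longLeg hjm : ℂ) * Complex.I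

/-- The prototiles: the first one is the right triangle with vertices `0`, `-a` and
`-a + i √(1 - a ^ 2)`, and the others are its multiples by powers of the factor. -/
def triangle {m j : ℕ} (hjm : j < m) (i : Fin m) : Set ℂ :=
  (fun z : ℂ => (pythagorasFactor hjm : ℂ) ^ (i : ℕ) * z) ''
    convexHull ℝ {0, -(shortLeg hjm : ℂ), apex hjm}

/-- The Pythagoras substitution. The last prototile, enlarged by `lam`, is the triangle with
vertices `0`, `-1` (right angle) and `-1 + i lam ^ j`; its altitude on the hypotenuse dissects
it into a copy of `T_1` (with vertices `0`, `a * apex`, `-1`) and a copy of `T_{j+1}`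
(with vertices `-1`, `a * apex`, `-1 + i lam ^ j`), both of them mirror images. -/
def pythagoras {m j : ℕ} (hjm : j < m) : Substitution m where
  factor := pythagorasFactor hjm
  proto := triangle hjm
  rule i :=
    if h : (i : ℕ) + 1 < m then {(⟨i + 1, h⟩, 1)}
    else {(⟨0, by omega⟩, mirror (-theta hjm) 0),
      (⟨j, hjm⟩, mirror (-theta hjm - Real.pi / 2) (-1))}

/-- The two tiles `T_{j+1}` in the `2m`-fold Pythagoras iterate of `T_1` which form a rectangle
and whose common side is the altitude on the hypotenuse of the large triangle. The rectangle has
the vertices `C = -lam ^ m`, `P = -a`, `H = apex`, `Q = -lam ^ m + i √(1 - a ^ 2)`, where `C` is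
the right-angled vertex of the large triangle and `H` the foot of its altitude; the tiles are
`H P C` and `C Q H`, listed as the images of the vertices of the prototile. -/
def oldPair {m j : ℕ} (hjm : j < m) : Set (Tile m) :=
  {(⟨j, hjm⟩, rot (Real.pi / 2) (apex hjm)),
    (⟨j, hjm⟩, rot (-(Real.pi / 2)) (-(pythagorasFactor hjm : ℂ) ^ m))}

/-- The two tiles `Q C P` and `P H Q` of type `T_{j+1}` that arise by dissecting the same
rectangle along its other diagonal. -/
def newPair {m j : ℕ} (hjm : j < m) : Set (Tile m) :=
  {(⟨j, hjm⟩, mirror (Real.pi / 2)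
      (-(pythagorasFactor hjm : ℂ) ^ m + (longLeg hjm : ℂ) * Complex.I)),
    (⟨j, hjm⟩, mirror (-(Real.pi / 2)) (-(shortLeg hjm : ℂ)))}

/-- The Pythia substitution: `T_1` is replaced by the `2m`-fold Pythagoras iterate of `T_1` with
the diagonal of the rectangle switched, and `T_{i+1}` by the `i`-fold Pythagoras iterate of this
patch. -/
def pythia {m j : ℕ} (hjm : j < m) : Substitution m where
  factor := pythagorasFactor hjm ^ (2 * m)
  proto := triangle hjm
  rule i := (pythagoras hjm).apply^[i]
    (((pythagoras hjm).supertile (2 * m) ⟨0, by omega⟩ \ oldPair hjm) ∪ newPair hjm)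

end SubstTiling

end

namespace SubstTiling

/-! ### Motions -/

/-! By Weyl's criterion (`tendsto_ncard_angle_div`), the angles equidistribute along a family of
patches once, for every p ≥ 1, the sum of exp(i p α) over the tiles is o(number of tiles). A motion
only multiplies such a sum by a unit, after a conjugation if it reverses orientation. Hence its
modulus over a supertile depends only on the prototile and the order.

The areas `weight` form an eigenvector of ρ with eigenvalue λ^(4m). Suppose that each order-l
supertile contains two tiles of one type and one handedness whose directions have different p-th
powers. Substituting k more times turns the two tiles into supertiles whose sums are u·W and u'·W,
or the same with conj W, where |u + u'| < 2. This partial cancellation lowers the ratio of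
exponential sum to area by a fixed factor r < 1 every l levels, so the ratio decays geometrically
(`exists_norm_weylSum_le`).

Such tiles exist because of the switched diagonal. Two substitutions of T_{m-j+1} produce mirrored
copies of T_{j+1} with directions exp(-iθ) and -exp(iθ) (`exists_interfere`). Their p-th powers
differ because exp(iθ) is not a root of unity (`exp_theta_pow_ne_one`): cos θ = a is an algebraic
integer, so for a root of unity Kronecker's theorem would make a itself a root of unity, while 0 < a
< 1. Primitivity (`pythia_isPrimitive`) carries the pair into supertiles of all types.

For balls, the patch of tiles meeting a ball sits in a large supertile and splits into complete
order-k supertiles and a remainder (`norm_weylSum_le_of_subset`). The remainder lies in an annulus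
of bounded width, so it has O(r) tiles, against at least δr² tiles in the patch. -/

theorem motion_apply (g : Motion) (z : ℂ) : g z = g.linearIsometryEquiv z + g 0 := by
  simpa using g.map_vadd 0 z

theorem motion_ext {g h : Motion} (hlin : ∀ z, g.linearIsometryEquiv z = h.linearIsometryEquiv z)
    (h0 : g 0 = h 0) : g = h := by
  ext z
  rw [motion_apply, motion_apply h, hlin, h0]

theorem linear_mul (g h : Motion) (z : ℂ) :
    (g * h).linearIsometryEquiv z = g.linearIsometryEquiv (h.linearIsometryEquiv z) := rfl

theorem linear_one (z : ℂ) : (1 : Motion).linearIsometryEquiv z = z := rfl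

theorem linear_dilate (c : ℝ) (g : Motion) (z : ℂ) :
    (dilate c g).linearIsometryEquiv z = g.linearIsometryEquiv z := rfl

theorem linear_rot (φ : ℝ) (t z : ℂ) :
    (rot φ t).linearIsometryEquiv z = Complex.exp (φ * Complex.I) * z := by
  have h := motion_apply (rot φ t) z
  rw [rot_apply, rot_apply] at h
  simpa using h.symm

theorem linear_mirror (φ : ℝ) (t z : ℂ) :
    (mirror φ t).linearIsometryEquiv z = Complex.exp (φ * Complex.I) * (starRingEnd ℂ) z := by
  have h := motion_apply (mirror φ t) z
  rw [mirror_apply, mirror_apply] at h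
  simpa using h.symm

theorem dilate_apply_zero (c : ℝ) (g : Motion) : dilate c g 0 = c * g 0 := by
  simp [dilate_apply]

theorem dilate_mul (c : ℝ) (g h : Motion) : dilate c (g * h) = dilate c g * dilate c h := by
  refine motion_ext (fun z => rfl) ?_
  rw [AffineIsometryEquiv.coe_mul, Function.comp_apply, motion_apply (dilate c g),
    dilate_apply_zero, dilate_apply_zero, dilate_apply_zero, linear_dilate,
    AffineIsometryEquiv.coe_mul, Function.comp_apply, motion_apply g (h 0), mul_add]
  congr 1
  simpa using (map_smul g.linearIsometryEquiv c (h 0)).symm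

theorem dilate_dilate (c d : ℝ) (g : Motion) : dilate c (dilate d g) = dilate (c * d) g := by
  refine motion_ext (fun z => rfl) ?_
  rw [dilate_apply_zero, dilate_apply_zero, dilate_apply_zero]
  push_cast
  ring

theorem dilate_one_left (g : Motion) : dilate 1 g = g := by
  refine motion_ext (fun z => rfl) ?_
  rw [dilate_apply_zero]
  simp

theorem dilate_one_right (c : ℝ) : dilate c 1 = 1 := by
  refine motion_ext (fun z => rfl) ?_
  rw [dilate_apply_zero]
  simp

open scoped Pointwise in
theorem dilate_image_smul (c : ℝ) (g : Motion) (X : Set ℂ) :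
    dilate c g '' (c • X) = c • (g '' X) := by
  rw [← image_smul, ← image_smul, image_image, image_image]
  refine image_congr fun z _ => ?_
  rw [dilate_apply, motion_apply g z, smul_add, map_smul]
  simp

theorem interior_image_motion (g : Motion) (X : Set ℂ) :
    interior (g '' X) = g '' interior X :=
  (g.toHomeomorph.image_interior X).symm

/-! ### Tiles and substitutions -/

theorem Tile.move_one {n : ℕ} (T : Tile n) : Tile.move 1 T = T := by
  simp [Tile.move]

theorem Tile.move_mul {n : ℕ} (g h : Motion) (T : Tile n) :
    Tile.move (g * h) T = Tile.move g (Tile.move h T) := by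
  simp [Tile.move, mul_assoc]

theorem Tile.move_injective {n : ℕ} (g : Motion) : Function.Injective (Tile.move (n := n) g) := by
  rintro ⟨i, a⟩ ⟨k, b⟩ h
  simpa [Tile.move] using h

theorem Tile.move_self {n : ℕ} (T : Tile n) : Tile.move T.2 (T.1, 1) = T := by
  simp [Tile.move]

namespace Substitution

variable {n : ℕ} (s : Substitution n)

theorem support_move (g : Motion) (T : Tile n) : s.support (T.move g) = g '' s.support T := by
  simp [support, Tile.move, image_image]

theorem apply_mono {P Q : Set (Tile n)} (h : P ⊆ Q) : s.apply P ⊆ s.apply Q :=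
  biUnion_subset_biUnion_left h

theorem apply_iUnion {ι : Sort*} (P : ι → Set (Tile n)) :
    s.apply (⋃ i, P i) = ⋃ i, s.apply (P i) := by
  simp only [apply, biUnion_iUnion]

theorem apply_union (P Q : Set (Tile n)) : s.apply (P ∪ Q) = s.apply P ∪ s.apply Q := by
  simp only [apply, biUnion_union]

theorem apply_singleton (T : Tile n) :
    s.apply {T} = Tile.move (dilate s.factor T.2) '' s.rule T.1 := by
  simp [apply]

theorem apply_move (g : Motion) (P : Set (Tile n)) :
    s.apply (Tile.move g '' P) = Tile.move (dilate s.factor g) '' s.apply P := by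
  simp only [apply, image_iUnion, biUnion_image, image_image, ← Tile.move_mul, ← dilate_mul]
  rfl

theorem iterate_apply_mono (k : ℕ) {P Q : Set (Tile n)} (h : P ⊆ Q) :
    s.apply^[k] P ⊆ s.apply^[k] Q := by
  induction k with
  | zero => simpa
  | succ k ih => simpa only [Function.iterate_succ_apply'] using s.apply_mono ih

theorem iterate_apply_iUnion (k : ℕ) {ι : Sort*} (P : ι → Set (Tile n)) :
    s.apply^[k] (⋃ i, P i) = ⋃ i, s.apply^[k] (P i) := by
  induction k with
  | zero => simp
  | succ k ih => simp only [Function.iterate_succ_apply', ih, apply_iUnion]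

theorem iterate_apply_union (k : ℕ) (P Q : Set (Tile n)) :
    s.apply^[k] (P ∪ Q) = s.apply^[k] P ∪ s.apply^[k] Q := by
  induction k with
  | zero => simp
  | succ k ih => simp only [Function.iterate_succ_apply', ih, apply_union]

theorem iterate_apply_move (k : ℕ) (g : Motion) (P : Set (Tile n)) :
    s.apply^[k] (Tile.move g '' P) = Tile.move (dilate (s.factor ^ k) g) '' s.apply^[k] P := by
  induction k with
  | zero => simp [dilate_one_left]
  | succ k ih =>
    simp only [Function.iterate_succ_apply', ih, apply_move, dilate_dilate, pow_succ']

theorem iterate_apply_singleton (k : ℕ) (T : Tile n) :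
    s.apply^[k] {T} = Tile.move (dilate (s.factor ^ k) T.2) '' s.supertile k T.1 := by
  rw [supertile, ← iterate_apply_move, image_singleton, Tile.move_self]

/-- The hierarchical decomposition on which all counting rests: each tile of the patch contributes
one moved order-k supertile. -/
theorem iterate_apply_eq (k : ℕ) (P : Set (Tile n)) :
    s.apply^[k] P = ⋃ T ∈ P, Tile.move (dilate (s.factor ^ k) T.2) '' s.supertile k T.1 := by
  conv_lhs => rw [← biUnion_of_singleton P]
  simp only [iterate_apply_iUnion, iterate_apply_singleton]

theorem supertile_zero (i : Fin n) : s.supertile 0 i = {(i, 1)} := rfl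

theorem supertile_one (i : Fin n) : s.supertile 1 i = s.rule i := by
  rw [supertile, Function.iterate_one, apply_singleton]
  simp [dilate_one_right, Tile.move_one]

theorem supertile_add (k l : ℕ) (i : Fin n) :
    s.supertile (k + l) i = s.apply^[k] (s.supertile l i) :=
  Function.iterate_add_apply _ _ _ _

theorem move_mem_supertile_add {k l : ℕ} {i : Fin n} {T T' : Tile n}
    (hT : T ∈ s.supertile l i) (hT' : T' ∈ s.supertile k T.1) :
    T'.move (dilate (s.factor ^ k) T.2) ∈ s.supertile (k + l) i := by
  rw [supertile_add, iterate_apply_eq]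
  exact mem_biUnion hT (mem_image_of_mem _ hT')

end Substitution

/-! ### Packing substitutions: geometry of supertiles and area weights -/

namespace Substitution

open scoped Pointwise

variable {n : ℕ} (s : Substitution n)

/-- The tiles in `P` have pairwise disjoint interiors. -/
def Packs (P : Set (Tile n)) : Prop :=
  P.Pairwise fun T T' => Disjoint (interior (s.support T)) (interior (s.support T'))

/-- The prototiles are convex bodies, and the rule packs finitely many tiles into each enlarged
prototile. -/
structure IsPacking : Prop where
  factor_pos : 0 < s.factor
  convex : ∀ i, Convex ℝ (s.proto i)
  compact : ∀ i, IsCompact (s.proto i)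
  interior_nonempty : ∀ i, (interior (s.proto i)).Nonempty
  rule_finite : ∀ i, (s.rule i).Finite
  rule_packs : ∀ i, s.Packs (s.rule i)
  rule_subset : ∀ i, ∀ T ∈ s.rule i, s.support T ⊆ s.factor • s.proto i

variable {s}

theorem Packs.mono {P Q : Set (Tile n)} (hQ : s.Packs Q) (h : P ⊆ Q) : s.Packs P :=
  Set.Pairwise.mono h hQ

theorem disjoint_interior_image_motion {g : Motion} {X Y : Set ℂ} :
    Disjoint (interior (g '' X)) (interior (g '' Y)) ↔ Disjoint (interior X) (interior Y) := by
  rw [interior_image_motion, interior_image_motion, disjoint_image_iff g.injective]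

theorem disjoint_smul_set₀ {c : ℝ} (hc : c ≠ 0) {X Y : Set ℂ} (h : Disjoint X Y) :
    Disjoint (c • X) (c • Y) :=
  (disjoint_image_iff (smul_right_injective ℂ hc)).2 h

theorem Packs.move {P : Set (Tile n)} (hP : s.Packs P) (g : Motion) :
    s.Packs (Tile.move g '' P) := by
  rintro _ ⟨T, hT, rfl⟩ _ ⟨T', hT', rfl⟩ hne
  rw [support_move, support_move, disjoint_interior_image_motion]
  exact hP hT hT' fun h => hne (by rw [h])

theorem packs_singleton (T : Tile n) : s.Packs {T} := pairwise_singleton _ _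

namespace IsPacking

theorem support_interior_nonempty (hs : s.IsPacking) (T : Tile n) :
    (interior (s.support T)).Nonempty := by
  rw [support, interior_image_motion]
  exact (hs.interior_nonempty _).image _

theorem support_isCompact (hs : s.IsPacking) (T : Tile n) : IsCompact (s.support T) :=
  (hs.compact _).image T.2.continuous

theorem support_convex (hs : s.IsPacking) (T : Tile n) : Convex ℝ (s.support T) :=
  (hs.convex _).affine_image (T.2.toAffineEquiv : ℂ →ᵃ[ℝ] ℂ)

theorem support_subset_closure_interior (hs : s.IsPacking) (T : Tile n) :
    s.support T ⊆ closure (interior (s.support T)) := by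
  rw [(hs.support_convex T).closure_interior_eq_closure_of_nonempty_interior
    (hs.support_interior_nonempty T)]
  exact subset_closure

/-- A convex body is the closure of its interior. This upgrades a mere contact with an open set to
an overlap of interiors, which contradicts a packing. -/
theorem inter_interior_nonempty (hs : s.IsPacking) {T : Tile n} {O : Set ℂ} (hO : IsOpen O)
    (h : (s.support T ∩ O).Nonempty) : (O ∩ interior (s.support T)).Nonempty := by
  obtain ⟨z, hz, hzO⟩ := h
  exact mem_closure_iff.1 (hs.support_subset_closure_interior T hz) O hO hzO

theorem support_subset_of_mem_apply_singleton (hs : s.IsPacking) {T T' : Tile n}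
    (h : T' ∈ s.apply {T}) : s.support T' ⊆ s.factor • s.support T := by
  rw [apply_singleton] at h
  obtain ⟨T'', hT'', rfl⟩ := h
  rw [support_move, show s.support T = T.2 '' s.proto T.1 from rfl, ← dilate_image_smul]
  exact image_mono (hs.rule_subset _ _ hT'')

theorem disjoint_apply (hs : s.IsPacking) {T T' t t' : Tile n}
    (h : Disjoint (interior (s.support T)) (interior (s.support T')))
    (ht : t ∈ s.apply {T}) (ht' : t' ∈ s.apply {T'}) :
    Disjoint (interior (s.support t)) (interior (s.support t')) := by
  refine Disjoint.mono (interior_mono (hs.support_subset_of_mem_apply_singleton ht))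
    (interior_mono (hs.support_subset_of_mem_apply_singleton ht')) ?_
  rw [interior_smul₀ hs.factor_pos.ne', interior_smul₀ hs.factor_pos.ne']
  exact disjoint_smul_set₀ hs.factor_pos.ne' h

theorem packs_apply (hs : s.IsPacking) {P : Set (Tile n)} (hP : s.Packs P) :
    s.Packs (s.apply P) := by
  intro t ht t' ht' hne
  simp only [apply, mem_iUnion] at ht ht'
  obtain ⟨T, hT, h⟩ := ht
  obtain ⟨T', hT', h'⟩ := ht'
  by_cases hTT : T = T'
  · subst hTT
    exact (hs.rule_packs T.1).move _ h h' hne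
  · rw [← apply_singleton] at h h'
    exact hs.disjoint_apply (hP hT hT' hTT) h h'

theorem packs_iterate (hs : s.IsPacking) {P : Set (Tile n)} (hP : s.Packs P) (k : ℕ) :
    s.Packs (s.apply^[k] P) := by
  induction k with
  | zero => simpa
  | succ k ih => simpa only [Function.iterate_succ_apply'] using hs.packs_apply ih

theorem packs_supertile (hs : s.IsPacking) (k : ℕ) (i : Fin n) : s.Packs (s.supertile k i) :=
  hs.packs_iterate (packs_singleton _) k

theorem finite_apply (hs : s.IsPacking) {P : Set (Tile n)} (hP : P.Finite) :
    (s.apply P).Finite :=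
  hP.biUnion fun T _ => (hs.rule_finite T.1).image _

theorem finite_iterate (hs : s.IsPacking) {P : Set (Tile n)} (hP : P.Finite) (k : ℕ) :
    (s.apply^[k] P).Finite := by
  induction k with
  | zero => simpa
  | succ k ih => simpa only [Function.iterate_succ_apply'] using hs.finite_apply ih

theorem finite_supertile (hs : s.IsPacking) (k : ℕ) (i : Fin n) : (s.supertile k i).Finite :=
  hs.finite_iterate (finite_singleton _) k

theorem support_subset_of_mem_supertile (hs : s.IsPacking) {k : ℕ} {i : Fin n} {T : Tile n}
    (h : T ∈ s.supertile k i) : s.support T ⊆ s.factor ^ k • s.proto i := by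
  induction k generalizing T with
  | zero =>
    rw [supertile_zero, mem_singleton_iff] at h
    simp [h, support]
  | succ k ih =>
    rw [supertile, Function.iterate_succ_apply', apply] at h
    obtain ⟨T', hT', hT⟩ := mem_iUnion₂.1 h
    rw [← apply_singleton] at hT
    refine (hs.support_subset_of_mem_apply_singleton hT).trans ?_
    rw [pow_succ', mul_smul]
    exact smul_set_mono (ih hT')

/-- A common tile would have a nonempty interior contained in both enlarged interiors. Disjointness
of supertiles as sets of tiles is what lets sums split over them. -/
theorem disjoint_move_supertile (hs : s.IsPacking) (k : ℕ) {T T' : Tile n}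
    (h : Disjoint (interior (s.support T)) (interior (s.support T'))) :
    Disjoint (Tile.move (dilate (s.factor ^ k) T.2) '' s.supertile k T.1)
      (Tile.move (dilate (s.factor ^ k) T'.2) '' s.supertile k T'.1) := by
  have key : ∀ U : Tile n, ∀ t ∈ Tile.move (dilate (s.factor ^ k) U.2) '' s.supertile k U.1,
      interior (s.support t) ⊆ s.factor ^ k • interior (s.support U) := by
    rintro U _ ⟨t, ht, rfl⟩
    rw [support_move, ← interior_smul₀ (pow_pos hs.factor_pos k).ne',
      show s.support U = U.2 '' s.proto U.1 from rfl, ← dilate_image_smul]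
    exact interior_mono (image_mono (hs.support_subset_of_mem_supertile ht))
  rw [Set.disjoint_left]
  intro t ht ht'
  obtain ⟨z, hz⟩ := hs.support_interior_nonempty t
  exact Set.disjoint_left.1 
    (disjoint_smul_set₀ (pow_pos hs.factor_pos k).ne' h) (key T t ht hz)
    (key T' t ht' hz)

theorem disjoint_iterate (hs : s.IsPacking) (k : ℕ) {P Q : Set (Tile n)}
    (hPQ : s.Packs (P ∪ Q)) (h : Disjoint P Q) :
    Disjoint (s.apply^[k] P) (s.apply^[k] Q) := by
  rw [iterate_apply_eq, iterate_apply_eq]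
  simp only [disjoint_iUnion_left, disjoint_iUnion_right]
  intro T hT T' hT'
  exact hs.disjoint_move_supertile k
    (hPQ (Or.inl hT') (Or.inr hT) fun he => Set.disjoint_left.1 h (he ▸ hT') hT)

theorem finsum_iterate (hs : s.IsPacking) {M : Type*} [AddCommMonoid M] {P : Set (Tile n)}
    (hP : s.Packs P) (hfin : P.Finite) (k : ℕ) (f : Tile n → M) :
    ∑ᶠ t ∈ s.apply^[k] P, f t =
      ∑ᶠ T ∈ P, ∑ᶠ t ∈ s.supertile k T.1, f (t.move (dilate (s.factor ^ k) T.2)) := by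
  rw [iterate_apply_eq, finsum_mem_biUnion _ hfin
    fun T _ => (hs.finite_supertile k T.1).image _]
  · exact finsum_mem_congr rfl fun T _ => finsum_mem_image (Tile.move_injective _).injOn
  · intro T hT T' hT' hne
    exact hs.disjoint_move_supertile k (hP hT hT' hne)

theorem finsum_supertile_add (hs : s.IsPacking) {M : Type*} [AddCommMonoid M] (k l : ℕ)
    (i : Fin n) (f : Tile n → M) :
    ∑ᶠ t ∈ s.supertile (k + l) i, f t =
      ∑ᶠ T ∈ s.supertile l i, ∑ᶠ t ∈ s.supertile k T.1,
        f (t.move (dilate (s.factor ^ k) T.2)) := by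
  rw [supertile_add, hs.finsum_iterate (hs.packs_supertile l i) (hs.finite_supertile l i)]

/-- An eigenvector of the substitution matrix measures all supertiles. -/
theorem finsum_weight_iterate (hs : s.IsPacking) {v : Fin n → ℝ} {q : ℝ}
    (hv : ∀ i, ∑ᶠ T ∈ s.rule i, v T.1 = q * v i) {P : Set (Tile n)} (hP : s.Packs P)
    (hfin : P.Finite) (k : ℕ) :
    ∑ᶠ T ∈ s.apply^[k] P, v T.1 = q ^ k * ∑ᶠ T ∈ P, v T.1 := by
  induction k with
  | zero => simp
  | succ k ih =>
    have h := hs.finsum_iterate (hs.packs_iterate hP k) (hs.finite_iterate hfin k) 1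
      (fun T => v T.1)
    rw [Function.iterate_one] at h
    rw [Function.iterate_succ_apply', h, pow_succ' q, mul_assoc, ← ih,
      mul_finsum_mem]
    refine finsum_mem_congr rfl fun T _ => ?_
    rw [supertile_one, ← hv]
    rfl

theorem finsum_weight_supertile (hs : s.IsPacking) {v : Fin n → ℝ} {q : ℝ}
    (hv : ∀ i, ∑ᶠ T ∈ s.rule i, v T.1 = q * v i) (k : ℕ) (i : Fin n) :
    ∑ᶠ T ∈ s.supertile k i, v T.1 = q ^ k * v i := by
  rw [supertile, hs.finsum_weight_iterate hv (packs_singleton _) (finite_singleton _),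
    finsum_mem_singleton]

end IsPacking

end Substitution

/-! ### Exponential sums over tile directions and interference -/

theorem linear_eq_or (g : Motion) :
    (∀ z, g.linearIsometryEquiv z = g.linearIsometryEquiv 1 * z) ∨
      ∀ z, g.linearIsometryEquiv z = g.linearIsometryEquiv 1 * (starRingEnd ℂ) z := by
  obtain ⟨a, h | h⟩ := linear_isometry_complex g.linearIsometryEquiv
  · left; intro z; simp [h]
  · right; intro z; simp [h]

theorem norm_linear_one (g : Motion) : ‖g.linearIsometryEquiv 1‖ = 1 := by
  simp

theorem norm_finsum_mem_le {α E : Type*} [SeminormedAddCommGroup E] {P : Set α} (hP : P.Finite)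
    (f : α → E) : ‖∑ᶠ t ∈ P, f t‖ ≤ ∑ᶠ t ∈ P, ‖f t‖ := by
  rw [finsum_mem_eq_finite_toFinset_sum _ hP, finsum_mem_eq_finite_toFinset_sum _ hP]
  exact norm_sum_le _ _

theorem finsum_mem_le_finsum_mem_of_finite {α : Type*} {P : Set α} (hP : P.Finite)
    {f g : α → ℝ} (h : ∀ t ∈ P, f t ≤ g t) : ∑ᶠ t ∈ P, f t ≤ ∑ᶠ t ∈ P, g t := by
  rw [finsum_mem_eq_finite_toFinset_sum _ hP, finsum_mem_eq_finite_toFinset_sum _ hP]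
  exact Finset.sum_le_sum fun t ht => h t (hP.mem_toFinset.1 ht)

theorem finsum_mem_const {α : Type*} {P : Set α} (hP : P.Finite) (c : ℝ) :
    ∑ᶠ _t ∈ P, c = P.ncard * c := by
  rw [finsum_mem_eq_finite_toFinset_sum _ hP, Finset.sum_const, nsmul_eq_mul,
    ncard_eq_toFinset_card _ hP]

/-- The direction `exp (i α)` of a tile with the angle `α`. -/
noncomputable def Tile.dir {n : ℕ} (T : Tile n) : ℂ := T.2.linearIsometryEquiv 1

theorem Tile.norm_dir {n : ℕ} (T : Tile n) : ‖T.dir‖ = 1 := norm_linear_one _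

theorem Tile.dir_move {n : ℕ} (g : Motion) (T : Tile n) :
    (T.move g).dir = g.linearIsometryEquiv T.dir := rfl

/-- The exponential sum of frequency `p` over the angles of the tiles in `P`. -/
noncomputable def weylSum {n : ℕ} (p : ℕ) (P : Set (Tile n)) : ℂ := ∑ᶠ T ∈ P, T.dir ^ p

theorem norm_weylSum_le {n : ℕ} (p : ℕ) {P : Set (Tile n)} (hP : P.Finite) :
    ‖weylSum p P‖ ≤ P.ncard := by
  refine (norm_finsum_mem_le hP _).trans ?_
  simp [norm_pow, Tile.norm_dir, finsum_mem_const hP]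

theorem weylSum_move_rot {n : ℕ} (p : ℕ) {P : Set (Tile n)} {g : Motion}
    (hg : ∀ z, g.linearIsometryEquiv z = g.linearIsometryEquiv 1 * z) :
    weylSum p (Tile.move g '' P) = g.linearIsometryEquiv 1 ^ p * weylSum p P := by
  rw [weylSum, finsum_mem_image (Tile.move_injective g).injOn, weylSum, mul_finsum_mem]
  refine finsum_mem_congr rfl fun T _ => ?_
  rw [Tile.dir_move, hg, mul_pow]

theorem weylSum_move_mirror {n : ℕ} (p : ℕ) {P : Set (Tile n)} (hP : P.Finite) {g : Motion}
    (hg : ∀ z, g.linearIsometryEquiv z = g.linearIsometryEquiv 1 * (starRingEnd ℂ) z) :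
    weylSum p (Tile.move g '' P) =
      g.linearIsometryEquiv 1 ^ p * (starRingEnd ℂ) (weylSum p P) := by
  have h := (starRingEnd ℂ).toAddMonoidHom.map_finsum_mem (fun T : Tile n => T.dir ^ p) hP
  simp only [RingHom.toAddMonoidHom_eq_coe, AddMonoidHom.coe_coe] at h
  rw [weylSum, finsum_mem_image (Tile.move_injective g).injOn, weylSum, h, mul_finsum_mem]
  refine finsum_mem_congr rfl fun T _ => ?_
  rw [Tile.dir_move, hg, mul_pow, map_pow]

theorem norm_weylSum_move {n : ℕ} (p : ℕ) {P : Set (Tile n)} (hP : P.Finite) (g : Motion) :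
    ‖weylSum p (Tile.move g '' P)‖ = ‖weylSum p P‖ := by
  obtain h | h := linear_eq_or g
  · rw [weylSum_move_rot p h, norm_mul, norm_pow, norm_linear_one, one_pow, one_mul]
  · rw [weylSum_move_mirror p hP h, norm_mul, norm_pow, norm_linear_one, one_pow, one_mul,
      RCLike.norm_conj]

/-- Two tiles of the same type and the same handedness whose contributions to the exponential
sums of frequency `p` are not aligned. -/
structure Interfere {n : ℕ} (p : ℕ) (T T' : Tile n) : Prop where
  type_eq : T.1 = T'.1
  ne : T.dir ^ p ≠ T'.dir ^ p
  handed : ((∀ z, T.2.linearIsometryEquiv z = T.dir * z) ∧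
      ∀ z, T'.2.linearIsometryEquiv z = T'.dir * z) ∨
    ((∀ z, T.2.linearIsometryEquiv z = T.dir * (starRingEnd ℂ) z) ∧
      ∀ z, T'.2.linearIsometryEquiv z = T'.dir * (starRingEnd ℂ) z)

theorem Interfere.move {n p : ℕ} {T T' : Tile n} (h : Interfere p T T') (g : Motion) :
    Interfere p (T.move g) (T'.move g) := by
  obtain hg | hg := linear_eq_or g
  · refine ⟨h.type_eq, ?_, ?_⟩
    · rw [Tile.dir_move, Tile.dir_move, hg, hg T'.dir, mul_pow, mul_pow]
      exact fun he => h.ne (mul_left_cancel₀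
        (pow_ne_zero _ (norm_ne_zero_iff.1 (by rw [norm_linear_one]; exact one_ne_zero))) he)
    · simp only [Tile.dir_move]
      refine h.handed.imp (fun ⟨h1, h2⟩ => ⟨fun z => ?_, fun z => ?_⟩)
        fun ⟨h1, h2⟩ => ⟨fun z => ?_, fun z => ?_⟩
      · change g.linearIsometryEquiv (T.2.linearIsometryEquiv z) = _
        rw [h1, hg, hg T.dir, mul_assoc]
      · change g.linearIsometryEquiv (T'.2.linearIsometryEquiv z) = _
        rw [h2, hg, hg T'.dir, mul_assoc]
      · change g.linearIsometryEquiv (T.2.linearIsometryEquiv z) = _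
        rw [h1, hg, hg T.dir, mul_assoc]
      · change g.linearIsometryEquiv (T'.2.linearIsometryEquiv z) = _
        rw [h2, hg, hg T'.dir, mul_assoc]
  · refine ⟨h.type_eq, ?_, ?_⟩
    · rw [Tile.dir_move, Tile.dir_move, hg, hg T'.dir, mul_pow, mul_pow, ← map_pow (starRingEnd ℂ),
        ← map_pow (starRingEnd ℂ)]
      exact fun he => h.ne ((starRingEnd ℂ).injective (mul_left_cancel₀
        (pow_ne_zero _ (norm_ne_zero_iff.1 (by rw [norm_linear_one]; exact one_ne_zero))) he))
    · simp only [Tile.dir_move]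
      -- A reflection reverses the handedness of both tiles, so the two alternatives change places.
      refine h.handed.symm.imp (fun ⟨h1, h2⟩ => ⟨fun z => ?_, fun z => ?_⟩)
        fun ⟨h1, h2⟩ => ⟨fun z => ?_, fun z => ?_⟩
      · change g.linearIsometryEquiv (T.2.linearIsometryEquiv z) = _
        rw [h1, hg, hg T.dir, map_mul, Complex.conj_conj, mul_assoc]
      · change g.linearIsometryEquiv (T'.2.linearIsometryEquiv z) = _
        rw [h2, hg, hg T'.dir, map_mul, Complex.conj_conj, mul_assoc]
      · change g.linearIsometryEquiv (T.2.linearIsometryEquiv z) = _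
        rw [h1, hg, hg T.dir, map_mul, mul_assoc]
      · change g.linearIsometryEquiv (T'.2.linearIsometryEquiv z) = _
        rw [h2, hg, hg T'.dir, map_mul, mul_assoc]

/-- Strict convexity of the plane: distinct unit vectors are not on one ray, so the triangle
inequality is strict. -/
theorem Interfere.norm_add_lt {n p : ℕ} {T T' : Tile n} (h : Interfere p T T') :
    ‖T.dir ^ p + T'.dir ^ p‖ < 2 := by
  have h1 : ‖T.dir ^ p‖ = 1 := by rw [norm_pow, Tile.norm_dir, one_pow]
  have h2 : ‖T'.dir ^ p‖ = 1 := by rw [norm_pow, Tile.norm_dir, one_pow]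
  have h3 := norm_add_lt_of_not_sameRay (mt (sameRay_iff_of_norm_eq (h1.trans h2.symm)).1 h.ne)
  rw [h1, h2] at h3
  linarith

/-- Equal handedness means that both sums contain the same factor, the sum over `P` or its
conjugate, and it can be pulled out. -/
theorem Interfere.norm_weylSum_add {n p : ℕ} {T T' : Tile n} (h : Interfere p T T') (c : ℝ)
    {P : Set (Tile n)} (hP : P.Finite) :
    ‖weylSum p (Tile.move (dilate c T.2) '' P) + weylSum p (Tile.move (dilate c T'.2) '' P)‖ =
      ‖T.dir ^ p + T'.dir ^ p‖ * ‖weylSum p P‖ := by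
  obtain ⟨h1, h2⟩ | ⟨h1, h2⟩ := h.handed
  · rw [weylSum_move_rot p (g := dilate c T.2) h1, weylSum_move_rot p (g := dilate c T'.2) h2,
      ← add_mul, norm_mul]
    rfl
  · rw [weylSum_move_mirror p hP (g := dilate c T.2) h1,
      weylSum_move_mirror p hP (g := dilate c T'.2) h2, ← add_mul, norm_mul, RCLike.norm_conj]
    rfl

/-! ### Geometric decay of exponential sums over supertiles -/

namespace Substitution

variable {n : ℕ} {s : Substitution n}

namespace IsPacking

theorem weylSum_supertile_add (hs : s.IsPacking) (p k l : ℕ) (i : Fin n) :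
    weylSum p (s.supertile (k + l) i) = ∑ᶠ T ∈ s.supertile l i,
      weylSum p (Tile.move (dilate (s.factor ^ k) T.2) '' s.supertile k T.1) := by
  rw [weylSum, hs.finsum_supertile_add]
  refine finsum_mem_congr rfl fun T _ => ?_
  rw [weylSum, finsum_mem_image (Tile.move_injective _).injOn]

/-- Triangle inequality over the order-`k` supertiles, except that the interfering pair is kept
together: it costs |u + u'| instead of 2 copies of the bound for its type, and the difference is the
gain. -/
theorem norm_weylSum_supertile_add_le (hs : s.IsPacking) {v : Fin n → ℝ} {q : ℝ}
    (hv : ∀ i, ∑ᶠ T ∈ s.rule i, v T.1 = q * v i) {p k l : ℕ} {C : ℝ}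
    (hC : ∀ i, ‖weylSum p (s.supertile k i)‖ ≤ C * v i) {i : Fin n} {T T' : Tile n}
    (hT : T ∈ s.supertile l i) (hT' : T' ∈ s.supertile l i) (h : Interfere p T T') :
    ‖weylSum p (s.supertile (k + l) i)‖ ≤
      C * (q ^ l * v i - (2 - ‖T.dir ^ p + T'.dir ^ p‖) * v T.1) := by
  have hne : T ≠ T' := fun he => h.ne (by rw [he])
  have hfin := hs.finite_supertile l i
  have hpair : ({T, T'} : Set (Tile n)) ⊆ s.supertile l i := by
    rintro _ (rfl | rfl) <;> assumption
  have hsplit := fun {M : Type} [AddCommMonoid M] (f : Tile n → M) =>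
    finsum_mem_add_sdiff (f := f) hpair hfin
  have hw := hsplit fun U => v U.1
  rw [hs.finsum_weight_supertile hv, finsum_mem_pair hne, ← h.type_eq] at hw
  have hdiff : (s.supertile l i \ {T, T'}).Finite := hfin.sdiff
  rw [hs.weylSum_supertile_add, ← hsplit, finsum_mem_pair hne]
  have hTT := h.norm_weylSum_add (s.factor ^ k) (hs.finite_supertile k T.1)
  rw [h.type_eq] at hTT
  rw [h.type_eq]
  have hrest : ‖∑ᶠ U ∈ s.supertile l i \ {T, T'},
      weylSum p (Tile.move (dilate (s.factor ^ k) U.2) '' s.supertile k U.1)‖ ≤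
      C * ∑ᶠ U ∈ s.supertile l i \ {T, T'}, v U.1 := by
    refine (norm_finsum_mem_le hdiff _).trans ?_
    rw [mul_finsum_mem]
    refine finsum_mem_le_finsum_mem_of_finite hdiff fun U _ => ?_
    rw [norm_weylSum_move p (hs.finite_supertile k U.1)]
    exact hC _
  have hmul := mul_le_mul_of_nonneg_left (hC T'.1) (norm_nonneg (T.dir ^ p + T'.dir ^ p))
  rw [h.type_eq] at hw
  calc _ ≤ _ := norm_add_le _ _
    _ ≤ ‖T.dir ^ p + T'.dir ^ p‖ * (C * v T'.1) +
        C * ∑ᶠ U ∈ s.supertile l i \ {T, T'}, v U.1 := by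
      rw [hTT]; exact add_le_add hmul hrest
    _ = _ := by rw [← hw]; ring

/-- If every supertile of order `l` contains interfering tiles, then the exponential sums over
supertiles grow more slowly than the number of tiles. -/
theorem exists_norm_weylSum_le (hs : s.IsPacking) {v : Fin n → ℝ} {q : ℝ}
    (hv : ∀ i, ∑ᶠ T ∈ s.rule i, v T.1 = q * v i) (hq : 0 < q) (hv1 : ∀ i, 1 ≤ v i) {p l : ℕ}
    (hl : ∀ i, ∃ T ∈ s.supertile l i, ∃ T' ∈ s.supertile l i, Interfere p T T') :
    ∃ r : ℝ, 0 < r ∧ r < 1 ∧ ∀ a b i,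
      ‖weylSum p (s.supertile (b + l * a) i)‖ ≤ r ^ a * q ^ (b + l * a) * v i := by
  choose T hT T' hT' h using hl
  have hpos : ∀ i, 0 < q ^ l * v i := fun i =>
    mul_pos (pow_pos hq l) (one_pos.trans_le (hv1 i))
  -- The inequality is strict at `r = 1` and there are finitely many prototiles, so one r slightly
  -- below 1 serves them all.
  have hev : ∀ᶠ r : ℝ in 𝓝[<] 1, ∀ i, q ^ l * v i -
      (2 - ‖(T i).dir ^ p + (T' i).dir ^ p‖) * v (T i).1 ≤ r * (q ^ l * v i) := by
    rw [eventually_all]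
    intro i
    have h1 : Tendsto (fun r : ℝ => r * (q ^ l * v i)) (𝓝[<] 1) (𝓝 (1 * (q ^ l * v i))) :=
      (tendsto_id.mul_const _).mono_left nhdsWithin_le_nhds
    refine (h1.eventually (lt_mem_nhds ?_)).mono fun r hr => hr.le
    have := mul_pos (sub_pos.2 (h i).norm_add_lt) (one_pos.trans_le (hv1 (T i).1))
    linarith
  have hev0 : ∀ᶠ r : ℝ in 𝓝[<] 1, 0 < r :=
    nhdsWithin_le_nhds (lt_mem_nhds one_pos)
  obtain ⟨r, ⟨hr, hr0⟩, hr1⟩ := ((hev.and hev0).and self_mem_nhdsWithin).exists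
  refine ⟨r, hr0, hr1, fun a => ?_⟩
  induction a with
  | zero =>
    intro b i
    -- At level zero the trivial bound suffices: the number of tiles is at most their total weight,
    -- as all weights are at least 1.
    refine (norm_weylSum_le p (hs.finite_supertile _ i)).trans ?_
    rw [pow_zero, one_mul, mul_zero, add_zero, ← hs.finsum_weight_supertile hv,
      ← mul_one (((s.supertile b i).ncard : ℝ)), ← finsum_mem_const (hs.finite_supertile _ i)]
    exact finsum_mem_le_finsum_mem_of_finite (hs.finite_supertile _ i) fun T _ => hv1 _
  | succ a ih =>
    intro b i
    have := hs.norm_weylSum_supertile_add_le hv (ih b) (hT i) (hT' i) (h i)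
    rw [mul_add_one, ← add_assoc]
    refine this.trans ?_
    calc _ ≤ r ^ a * q ^ (b + l * a) * (r * (q ^ l * v i)) := by
          gcongr
          exact hr i
      _ = _ := by rw [pow_add q (b + l * a) l]; ring

theorem eventually_norm_weylSum_le (hs : s.IsPacking) {v : Fin n → ℝ} {q : ℝ}
    (hv : ∀ i, ∑ᶠ T ∈ s.rule i, v T.1 = q * v i) (hq : 0 < q) (hv1 : ∀ i, 1 ≤ v i) {p l : ℕ}
    (hl : ∀ i, ∃ T ∈ s.supertile l i, ∃ T' ∈ s.supertile l i, Interfere p T T') {ε : ℝ}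
    (hε : 0 < ε) :
    ∃ k₀, ∀ k ≥ k₀, ∀ i,
      ‖weylSum p (s.supertile k i)‖ ≤ ε * (s.supertile k i).ncard := by
  obtain hn | hn := isEmpty_or_nonempty (Fin n)
  · exact ⟨0, fun k _ i => hn.elim i⟩
  -- A supertile of order 0 is a single tile and cannot contain an interfering pair; `l > 0` is
  -- needed to divide `k` by `l`.
  have hl0 : 0 < l := by
    rw [Nat.pos_iff_ne_zero]
    rintro rfl
    obtain ⟨T, hT, T', hT', h⟩ := hl hn.some
    rw [supertile_zero, mem_singleton_iff] at hT hT'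
    exact h.ne (by rw [hT, hT'])
  obtain ⟨r, hr0, hr1, hr⟩ := hs.exists_norm_weylSum_le hv hq hv1 hl
  obtain ⟨B, hB⟩ := (finite_range v).bddAbove
  have hB' : ∀ i, v i ≤ B := fun i => hB (mem_range_self i)
  have hB0 : 0 < B := one_pos.trans_le ((hv1 hn.some).trans (hB' _))
  obtain ⟨a₀, ha₀⟩ := exists_pow_lt_of_lt_one (div_pos hε hB0) hr1
  -- Writing `k = k % l + l * (k / l)`, the factor `r ^ (k / l)` is at most ε / B, and `B`, a bound
  -- for the weights, converts total weight back into a number of tiles.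
  refine ⟨l * a₀, fun k hk i => ?_⟩
  have hk' := hr (k / l) (k % l) i
  rw [Nat.mod_add_div, mul_assoc, ← hs.finsum_weight_supertile hv] at hk'
  have hcard : ∑ᶠ T ∈ s.supertile k i, v T.1 ≤ (s.supertile k i).ncard * B := by
    rw [← finsum_mem_const (hs.finite_supertile k i)]
    exact finsum_mem_le_finsum_mem_of_finite (hs.finite_supertile k i) fun T _ => hB' _
  have ha : r ^ (k / l) ≤ ε / B :=
    (pow_le_pow_of_le_one hr0.le hr1.le ((Nat.le_div_iff_mul_le hl0).2 (by linarith))).trans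
      ha₀.le
  calc _ ≤ _ := hk'
    _ ≤ ε / B * ((s.supertile k i).ncard * B) :=
      mul_le_mul ha hcard (by
        rw [hs.finsum_weight_supertile hv]
        exact mul_nonneg (pow_nonneg hq.le k) (zero_le_one.trans (hv1 i)))
        (div_pos hε hB0).le
    _ = _ := by field_simp

end IsPacking

end Substitution

/-! ### Patches of tiles meeting a ball -/

namespace Substitution

open scoped Pointwise
open MeasureTheory

variable {n : ℕ} {s : Substitution n}

theorem volume_real_ball (a : ℂ) {r : ℝ} (hr : 0 ≤ r) :
    volume.real (Metric.ball a r) = r ^ 2 * Real.pi := by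
  rw [Measure.real, Complex.volume_ball, ENNReal.toReal_mul, ENNReal.toReal_pow,
    ENNReal.toReal_ofReal hr]
  rfl

theorem volume_real_closedBall (a : ℂ) {r : ℝ} (hr : 0 ≤ r) :
    volume.real (Metric.closedBall a r) = r ^ 2 * Real.pi := by
  rw [Measure.real, Complex.volume_closedBall, ENNReal.toReal_mul, ENNReal.toReal_pow,
    ENNReal.toReal_ofReal hr]
  rfl

/-- Only finitely many pairs of order and type have order below `k`. This turns "many tiles" into
"high order". -/
theorem exists_order_bound (s : Substitution n) (k : ℕ) :
    ∃ N, ∀ l i, N < (s.supertile l i).ncard → k ≤ l := by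
  obtain ⟨N, hN⟩ := (((finite_Iio k).prod (finite_univ (α := Fin n))).image
    fun x => (s.supertile x.1 x.2).ncard).bddAbove
  refine ⟨N, fun l i h => ?_⟩
  by_contra! hl
  exact absurd (hN ⟨(l, i), ⟨hl, mem_univ _⟩, rfl⟩) (not_le.2 h)

namespace IsPacking

theorem exists_inradius (hs : s.IsPacking) :
    ∃ ρ > 0, ∀ T, ∃ z, Metric.ball z ρ ⊆ interior (s.support T) := by
  choose z hz using hs.interior_nonempty
  have hev : ∀ᶠ ρ : ℝ in 𝓝[>] 0, ∀ i, Metric.ball (z i) ρ ⊆ interior (s.proto i) := by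
    rw [eventually_all]
    intro i
    obtain ⟨δ, hδ, hsub⟩ := Metric.isOpen_iff.1 isOpen_interior (z i) (hz i)
    filter_upwards [nhdsWithin_le_nhds (gt_mem_nhds hδ)] with ρ hρ
    exact (Metric.ball_subset_ball (le_of_lt hρ)).trans hsub
  obtain ⟨ρ, h, hρ⟩ := (hev.and self_mem_nhdsWithin).exists
  refine ⟨ρ, hρ, fun T => ⟨T.2 (z T.1), ?_⟩⟩
  rw [support, interior_image_motion]
  have hb := T.2.toIsometryEquiv.image_ball (z T.1) ρ
  rw [AffineIsometryEquiv.coe_toIsometryEquiv] at hb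
  rw [← hb]
  exact image_mono (h _)

theorem exists_diam_supertile (hs : s.IsPacking) (k : ℕ) :
    ∃ D > 0, ∀ T : Tile n, ∀ t ∈ Tile.move (dilate (s.factor ^ k) T.2) '' s.supertile k T.1,
      ∀ t' ∈ Tile.move (dilate (s.factor ^ k) T.2) '' s.supertile k T.1,
      ∀ z ∈ s.support t, ∀ z' ∈ s.support t', dist z z' ≤ D := by
  have hbd : ∀ i, Bornology.IsBounded (s.factor ^ k • s.proto i) := fun i =>
    ((hs.compact i).smul (s.factor ^ k)).isBounded
  obtain ⟨B, hB⟩ := (finite_range fun i => Metric.diam (s.factor ^ k • s.proto i)).bddAbove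
  refine ⟨max B 1, by positivity, ?_⟩
  rintro T _ ⟨t, ht, rfl⟩ _ ⟨t', ht', rfl⟩ z hz z' hz'
  rw [support_move] at hz hz'
  obtain ⟨w, hw, rfl⟩ := hz
  obtain ⟨w', hw', rfl⟩ := hz'
  rw [AffineIsometryEquiv.dist_map]
  exact (Metric.dist_le_diam_of_mem (hbd T.1) (hs.support_subset_of_mem_supertile ht hw)
    (hs.support_subset_of_mem_supertile ht' hw')).trans
      ((hB (mem_range_self T.1)).trans (le_max_left _ _))

theorem exists_diam (hs : s.IsPacking) :
    ∃ D > 0, ∀ T : Tile n, ∀ z ∈ s.support T, ∀ z' ∈ s.support T, dist z z' ≤ D := by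
  obtain ⟨D, hD, h⟩ := hs.exists_diam_supertile 0
  refine ⟨D, hD, fun T => h T T ?_ T ?_⟩ <;>
  simp [supertile_zero, dilate_one_left, Tile.move_self]

/-- The tiles contain disjoint discs of radius ρ. Stated for finite subfamilies so that it can also
prove that a bounded packing is finite. -/
theorem card_mul_le_volume {ρ : ℝ} (hρ : 0 < ρ)
    (hball : ∀ T, ∃ z, Metric.ball z ρ ⊆ interior (s.support T)) {P : Set (Tile n)}
    (hP : s.Packs P) {B : Set ℂ} (hB : volume B ≠ ⊤) (hPB : ∀ T ∈ P, s.support T ⊆ B)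
    (F : Finset (Tile n)) (hF : (F : Set (Tile n)) ⊆ P) :
    F.card * (ρ ^ 2 * Real.pi) ≤ volume.real B := by
  choose z hz using hball
  have hdisj : (F : Set (Tile n)).PairwiseDisjoint fun T => Metric.ball (z T) ρ :=
    fun T hT T' hT' hne => (hP (hF hT) (hF hT') hne).mono (hz T) (hz T')
  have h := measureReal_biUnion_finset (μ := volume) hdisj (fun T _ => measurableSet_ball)
  rw [Finset.sum_congr rfl fun T _ => volume_real_ball (z T) hρ.le, Finset.sum_const,
    nsmul_eq_mul] at h
  rw [← h]
  refine measureReal_mono (iUnion₂_subset fun T hT => ?_) hB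
  exact ((hz T).trans interior_subset).trans (hPB T (hF hT))

theorem finite_of_bounded (hs : s.IsPacking) {P : Set (Tile n)} (hP : s.Packs P) {B : Set ℂ}
    (hB : volume B ≠ ⊤) (hPB : ∀ T ∈ P, s.support T ⊆ B) : P.Finite := by
  obtain ⟨ρ, hρ, hball⟩ := hs.exists_inradius
  by_contra hinf
  obtain ⟨N, hN⟩ := exists_nat_gt (volume.real B / (ρ ^ 2 * Real.pi))
  obtain ⟨F, hF, rfl⟩ := Set.Infinite.exists_subset_card_eq hinf N
  have hpos : 0 < ρ ^ 2 * Real.pi := by positivity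
  rw [div_lt_iff₀ hpos] at hN
  exact absurd (card_mul_le_volume hρ hball hP hB hPB F hF) (not_le.2 hN)

/-- The exponential sum over a subset of a supertile is controlled by those over the supertiles
of order `k` it contains, and by the number of its remaining tiles. -/
theorem norm_weylSum_le_of_subset (hs : s.IsPacking) {p k l : ℕ} {i : Fin n} {ε : ℝ}
    (hε : 0 ≤ ε)
    (hk : ∀ i, ‖weylSum p (s.supertile k i)‖ ≤ ε * (s.supertile k i).ncard) {P : Set (Tile n)}
    (hP : P ⊆ s.supertile (k + l) i) :
    ‖weylSum p P‖ ≤ ε * P.ncard + ({t ∈ P | ∃ T : Tile n,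
      t ∈ Tile.move (dilate (s.factor ^ k) T.2) '' s.supertile k T.1 ∧
      ∃ t' ∈ Tile.move (dilate (s.factor ^ k) T.2) '' s.supertile k T.1,
        t' ∈ s.supertile (k + l) i ∧ t' ∉ P}).ncard := by
  set S : Tile n → Set (Tile n) :=
    fun T => Tile.move (dilate (s.factor ^ k) T.2) '' s.supertile k T.1 with hS
  set E := {t ∈ P | ∃ T : Tile n, t ∈ S T ∧ ∃ t' ∈ S T, t' ∈ s.supertile (k + l) i ∧ t' ∉ P}
    with hE
  have hPfin : P.Finite := (hs.finite_supertile _ _).subset hP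
  have hEfin : E.Finite := hPfin.subset (sep_subset _ _)
  have hSfin : ∀ T, (S T).Finite := fun T => (hs.finite_supertile k T.1).image _
  set R := {T ∈ s.supertile l i | S T ⊆ P} with hR
  have hRfin : R.Finite := (hs.finite_supertile l i).subset (sep_subset _ _)
  have hRdisj : R.PairwiseDisjoint S := fun T hT T' hT' hne =>
    hs.disjoint_move_supertile k (hs.packs_supertile l i hT.1 hT'.1 hne)
  set U := ⋃ T ∈ R, S T with hU
  have hUP : U ⊆ P := iUnion₂_subset fun T hT => hT.2
  have hUfin : U.Finite := hPfin.subset hUP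
  have hZ : s.supertile (k + l) i = ⋃ T ∈ s.supertile l i, S T := by
    rw [supertile_add, iterate_apply_eq]
  -- A tile of `P` outside every complete order-`k` supertile lies in one that also has a tile
  -- outside `P`, which puts it among the boundary tiles `E`.
  have hPE : P \ U ⊆ E := by
    rintro t ⟨htP, htU⟩
    obtain ⟨T, hT, htT⟩ := mem_iUnion₂.1 (hZ ▸ hP htP)
    refine ⟨htP, T, htT, ?_⟩
    by_contra! hcon
    refine htU (mem_iUnion₂.2 ⟨T, ⟨hT, fun t' ht' => hcon t' ht' ?_⟩, htT⟩)
    rw [hZ]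
    exact mem_iUnion₂.2 ⟨T, hT, ht'⟩
  have hsum : weylSum p P = weylSum p U + weylSum p (P \ U) :=
    (finsum_mem_add_sdiff hUP hPfin).symm
  have h1 : ‖weylSum p U‖ ≤ ε * U.ncard := by
    have hcard : (U.ncard : ℝ) = ∑ᶠ T ∈ R, ((S T).ncard : ℝ) := by
      rw [← mul_one (U.ncard : ℝ), ← finsum_mem_const hUfin, hU,
        finsum_mem_biUnion hRdisj hRfin fun T _ => hSfin T]
      refine finsum_mem_congr rfl fun T _ => ?_
      rw [finsum_mem_const (hSfin T), mul_one]
    rw [weylSum, hU, finsum_mem_biUnion hRdisj hRfin fun T _ => hSfin T, hcard, mul_finsum_mem]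
    refine (norm_finsum_mem_le hRfin _).trans (finsum_mem_le_finsum_mem_of_finite hRfin ?_)
    intro T _
    change ‖weylSum p (S T)‖ ≤ _
    rw [hS, norm_weylSum_move p (hs.finite_supertile k T.1),
      ncard_image_of_injective _ (Tile.move_injective _)]
    exact hk T.1
  have h2 : ‖weylSum p (P \ U)‖ ≤ E.ncard :=
    (norm_weylSum_le p hPfin.sdiff).trans (by exact_mod_cast ncard_le_ncard hPE hEfin)
  have h3 : (U.ncard : ℝ) ≤ P.ncard := by exact_mod_cast ncard_le_ncard hUP hPfin
  rw [hsum]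
  refine (norm_add_le _ _).trans (add_le_add (h1.trans ?_) h2)
  exact mul_le_mul_of_nonneg_left h3 hε

/-- The tiles of `𝒯` that meet the closed ball of radius `r` about the origin. -/
def ballTiles (s : Substitution n) (𝒯 : Set (Tile n)) (r : ℝ) : Set (Tile n) :=
  {T ∈ 𝒯 | (s.support T ∩ Metric.closedBall 0 r).Nonempty}

theorem finite_ballTiles (hs : s.IsPacking) {𝒯 : Set (Tile n)} (h𝒯 : s.IsTiling 𝒯) (r : ℝ) :
    (ballTiles s 𝒯 r).Finite := by
  obtain ⟨D, hD, hdiam⟩ := hs.exists_diam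
  refine hs.finite_of_bounded (B := Metric.closedBall 0 (r + D))
    (Packs.mono h𝒯.packs (sep_subset _ _)) measure_closedBall_lt_top.ne ?_
  rintro T ⟨_, z, hz, hzr⟩ w hw
  rw [Metric.mem_closedBall] at hzr ⊢
  have h1 := hdiam T w hw z hz
  have h2 := dist_triangle w z 0
  linarith

/-- The tiles cover the ball, and each lies in a disc of radius `D`, the common diameter bound;
compare areas. -/
theorem exists_le_card_ballTiles (hs : s.IsPacking) {𝒯 : Set (Tile n)} (h𝒯 : s.IsTiling 𝒯) :
    ∃ δ > 0, ∀ r ≥ 0, δ * r ^ 2 ≤ (ballTiles s 𝒯 r).ncard := by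
  obtain ⟨D, hD, hdiam⟩ := hs.exists_diam
  refine ⟨1 / D ^ 2, by positivity, fun r hr => ?_⟩
  have hfin := hs.finite_ballTiles h𝒯 r
  have hcov : Metric.closedBall (0 : ℂ) r ⊆ ⋃ T ∈ hfin.toFinset, s.support T := by
    intro z hz
    obtain ⟨T, hT, hzT⟩ := mem_iUnion₂.1 (h𝒯.covers ▸ mem_univ z)
    exact mem_iUnion₂.2 ⟨T, hfin.mem_toFinset.2 ⟨hT, z, hzT, hz⟩, hzT⟩
  have hvol : ∀ T, volume.real (s.support T) ≤ D ^ 2 * Real.pi := by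
    intro T
    obtain ⟨z, hz⟩ := hs.support_interior_nonempty T
    rw [← volume_real_closedBall z hD.le]
    exact measureReal_mono (fun w hw => hdiam T w hw z (interior_subset hz))
      measure_closedBall_lt_top.ne
  have h1 : r ^ 2 * Real.pi ≤ (ballTiles s 𝒯 r).ncard * (D ^ 2 * Real.pi) := by
    rw [← volume_real_closedBall 0 hr, ncard_eq_toFinset_card _ hfin, ← nsmul_eq_mul,
      ← Finset.sum_const]
    refine (measureReal_mono hcov ?_).trans ((measureReal_biUnion_finset_le _ _).trans
      (Finset.sum_le_sum fun T _ => hvol T))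
    exact ((measure_biUnion_lt_top hfin.toFinset.finite_toSet fun T _ =>
      (hs.support_isCompact T).measure_lt_top)).ne
  rw [← mul_assoc] at h1
  have h2 := le_of_mul_le_mul_right h1 Real.pi_pos
  rw [one_div_mul_eq_div, div_le_iff₀ (by positivity)]
  exact h2

/-- Only the supertiles cut by the edge of the ball escape the bound `hk`, and their contribution is
linear in `r`. -/
theorem norm_weylSum_ballTiles_le (hs : s.IsPacking) {𝒯 : Set (Tile n)}
    (h𝒯 : s.IsSubstitutionTiling 𝒯) {p : ℕ} {ε : ℝ} (hε : 0 < ε) {k : ℕ}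
    (hk : ∀ i, ‖weylSum p (s.supertile k i)‖ ≤ ε * (s.supertile k i).ncard) :
    ∃ C, ∀ᶠ r in atTop, ‖weylSum p (ballTiles s 𝒯 r)‖ ≤ ε * (ballTiles s 𝒯 r).ncard + C * r := by
  obtain ⟨D, hD, hdiam⟩ := hs.exists_diam_supertile k
  obtain ⟨N, hN⟩ := s.exists_order_bound k
  obtain ⟨δ, hδ, hcard⟩ := hs.exists_le_card_ballTiles h𝒯.isTiling
  obtain ⟨ρ, hρ, hball⟩ := hs.exists_inradius
  -- The annulus with radii r - D and r + D has area 4πDr; divide by the area πρ² of an inscribed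
  -- disc.
  refine ⟨4 * D / ρ ^ 2, ?_⟩
  have hlarge : Tendsto (fun r : ℝ => δ * r ^ 2) atTop atTop :=
    (tendsto_pow_atTop two_ne_zero).const_mul_atTop hδ
  filter_upwards [eventually_ge_atTop D, hlarge.eventually_gt_atTop (N : ℝ)] with r hrD hrN
  have hr0 : 0 ≤ r := hD.le.trans hrD
  have hfin := hs.finite_ballTiles h𝒯.isTiling r
  obtain ⟨K, i, g, hg⟩ := h𝒯.patch (ballTiles s 𝒯 r) (sep_subset _ _) hfin
  have hinj := Tile.move_injective (n := n) g
  have hKN : N < (s.supertile K i).ncard := by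
    have h1 : (N : ℝ) < (ballTiles s 𝒯 r).ncard := hrN.trans_le (hcard r hr0)
    rw [← ncard_image_of_injective _ hinj] at h1
    exact (Nat.cast_lt.1 h1).trans_le (ncard_le_ncard hg (hs.finite_supertile K i))
  obtain ⟨l, rfl⟩ := Nat.exists_eq_add_of_le (hN K i hKN)
  rw [← norm_weylSum_move p hfin g, ← ncard_image_of_injective _ hinj]
  refine (hs.norm_weylSum_le_of_subset hε.le hk hg).trans (add_le_add le_rfl ?_)
  set P := Tile.move g '' ballTiles s 𝒯 r with hP
  set E := {t ∈ P | ∃ T : Tile n,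
      t ∈ Tile.move (dilate (s.factor ^ k) T.2) '' s.supertile k T.1 ∧
      ∃ t' ∈ Tile.move (dilate (s.factor ^ k) T.2) '' s.supertile k T.1,
        t' ∈ s.supertile (k + l) i ∧ t' ∉ P} with hE
  -- The big supertile may contain tiles that do not come from 𝒯. None of them enters the open ball,
  -- since the tiling already covers it by tiles of `P`, and the supertile is a packing.
  have hmeet : ∀ t' ∈ s.supertile (k + l) i, t' ∉ P → ∀ z ∈ s.support t', r ≤ dist z (g 0) := by
    intro t' ht' htP z hz
    by_contra! hzr
    obtain ⟨w, hwr, hwt⟩ := hs.inter_interior_nonempty Metric.isOpen_ball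
      ⟨z, hz, Metric.mem_ball.2 hzr⟩
    obtain ⟨T, hT, hwT⟩ := mem_iUnion₂.1 (h𝒯.isTiling.covers ▸ mem_univ (g.symm w))
    have hTr : T ∈ ballTiles s 𝒯 r := by
      refine ⟨hT, g.symm w, hwT, ?_⟩
      rw [Metric.mem_closedBall, ← g.dist_map, g.apply_symm_apply]
      exact (Metric.mem_ball.1 hwr).le
    have hwT' : w ∈ s.support (T.move g) := by
      rw [support_move]
      exact ⟨_, hwT, g.apply_symm_apply w⟩
    obtain ⟨u, hut, huT⟩ := hs.inter_interior_nonempty isOpen_interior ⟨w, hwT', hwt⟩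
    have hTP : T.move g ∈ P := mem_image_of_mem _ hTr
    have hne : t' ≠ T.move g := fun he => htP (he ▸ hTP)
    exact Set.disjoint_left.1 (hs.packs_supertile _ _ ht' (hg hTP) hne) hut huT
  -- A boundary tile shares an order-`k` supertile, of diameter at most `D`, both with a point in
  -- the ball and with a tile at distance at least r from the centre.
  have hEsub : ∀ t ∈ E, s.support t ⊆
      Metric.closedBall (g 0) (r + D) \ Metric.ball (g 0) (r - D) := by
    rintro t ⟨⟨T₀, ⟨_, z₀, hz₀, hz₀r⟩, rfl⟩, T, htT, t', ht'T, ht', ht'P⟩ w hw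
    have hz₁ : g z₀ ∈ s.support (T₀.move g) := by
      rw [support_move]
      exact mem_image_of_mem _ hz₀
    have hz₁r : dist (g z₀) (g 0) ≤ r := by
      rw [g.dist_map]
      exact hz₀r
    obtain ⟨z', hz'⟩ := hs.support_interior_nonempty t'
    have hz'r := hmeet t' ht' ht'P z' (interior_subset hz')
    have d1 := hdiam T _ htT _ htT w hw _ hz₁
    have d2 := hdiam T _ htT _ ht'T w hw z' (interior_subset hz')
    have t1 := dist_triangle w (g z₀) (g 0)
    have t2 := dist_triangle_left z' (g 0) w
    refine ⟨Metric.mem_closedBall.2 (by linarith), fun hmem => ?_⟩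
    rw [Metric.mem_ball] at hmem
    linarith
  have hEfin : E.Finite := (hfin.image _).subset (sep_subset _ _)
  have hEP : s.Packs E :=
    (hs.packs_supertile (k + l) i).mono ((sep_subset _ _).trans hg)
  have hvol := card_mul_le_volume hρ hball hEP
    (measure_ne_top_of_subset sdiff_subset measure_closedBall_lt_top.ne) hEsub hEfin.toFinset
    (by rw [hEfin.coe_toFinset])
  rw [measureReal_sdiff (Metric.ball_subset_closedBall.trans
      (Metric.closedBall_subset_closedBall (by linarith))) measurableSet_ball
      measure_closedBall_lt_top.ne,
    volume_real_closedBall _ (by linarith), volume_real_ball _ (by linarith),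
    ← ncard_eq_toFinset_card _ hEfin] at hvol
  rw [div_mul_eq_mul_div, le_div_iff₀ (by positivity)]
  refine le_of_mul_le_mul_right ?_ Real.pi_pos
  linarith

theorem eventually_norm_weylSum_ballTiles_le (hs : s.IsPacking) {𝒯 : Set (Tile n)}
    (h𝒯 : s.IsSubstitutionTiling 𝒯) {p : ℕ}
    (hW : ∀ ε > 0, ∃ k₀, ∀ k ≥ k₀, ∀ i,
      ‖weylSum p (s.supertile k i)‖ ≤ ε * (s.supertile k i).ncard) :
    ∀ ε > 0, ∀ᶠ r in atTop, ‖weylSum p (ballTiles s 𝒯 r)‖ ≤ ε * (ballTiles s 𝒯 r).ncard := by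
  intro ε hε
  obtain ⟨k, hk⟩ := hW (ε / 2) (by positivity)
  obtain ⟨C, hC⟩ := hs.norm_weylSum_ballTiles_le h𝒯 (by positivity) (hk k le_rfl)
  obtain ⟨δ, hδ, hcard⟩ := hs.exists_le_card_ballTiles h𝒯.isTiling
  filter_upwards [hC, eventually_ge_atTop 0, eventually_ge_atTop (C / (ε / 2 * δ))]
    with r hr hr0 hrC
  refine hr.trans ?_
  rw [div_le_iff₀ (by positivity)] at hrC
  have h1 := mul_le_mul_of_nonneg_left (hcard r hr0) (half_pos hε).le
  have h2 := mul_le_mul_of_nonneg_right hrC hr0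
  nlinarith

theorem eventually_card_ballTiles_pos (hs : s.IsPacking) {𝒯 : Set (Tile n)} (h𝒯 : s.IsTiling 𝒯) :
    ∀ᶠ r in atTop, 0 < (ballTiles s 𝒯 r).ncard := by
  obtain ⟨δ, hδ, hcard⟩ := hs.exists_le_card_ballTiles h𝒯
  filter_upwards [eventually_gt_atTop 0] with r hr
  exact_mod_cast (show (0 : ℝ) < δ * r ^ 2 by positivity).trans_le (hcard r hr.le)

end IsPacking

end Substitution

/-! ### Weyl's criterion on the circle -/

section Weyl

open MeasureTheory AddCircle

variable {T : ℝ} [hT : Fact (0 < T)] {ι α : Type*} {L : Filter ι} {P : ι → Finset α}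
  {a : α → AddCircle T}

theorem integral_fourier (k : ℤ) :
    ∫ x, fourier k x ∂(haarAddCircle (T := T)) = if k = 0 then 1 else 0 := by
  have h := congrFun (fourierCoeff_fourier (T := T) k) 0
  rw [fourierCoeff] at h
  simp only [neg_zero, fourier_zero, one_smul] at h
  rw [h, Pi.single_apply]
  simp only [eq_comm]

theorem norm_average_le (i : ι) (f : C(AddCircle T, ℂ)) :
    ‖(∑ t ∈ P i, f (a t)) / ((P i).card : ℂ)‖ ≤ ‖f‖ := by
  rw [norm_div, Complex.norm_natCast]
  refine div_le_of_le_mul₀ (Nat.cast_nonneg _) (norm_nonneg f) ?_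
  refine (norm_sum_le _ _).trans ?_
  rw [mul_comm, ← nsmul_eq_mul, ← Finset.sum_const]
  exact Finset.sum_le_sum fun t _ => f.norm_coe_le_norm _

/-- Weyl's criterion for averages of continuous functions. -/
theorem tendsto_average (hP : ∀ᶠ i in L, (P i).Nonempty)
    (hW : ∀ p : ℕ, 0 < p →
      Tendsto (fun i => (∑ t ∈ P i, fourier p (a t)) / ((P i).card : ℂ)) L (𝓝 0))
    (f : C(AddCircle T, ℂ)) :
    Tendsto (fun i => (∑ t ∈ P i, f (a t)) / ((P i).card : ℂ)) L
      (𝓝 (∫ x, f x ∂haarAddCircle)) := by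
  have hinteg : ∀ g : C(AddCircle T, ℂ), Integrable g (haarAddCircle (T := T)) := fun g =>
    g.continuous.integrable_of_hasCompactSupport (HasCompactSupport.of_compactSpace _)
  have hspan : ∀ g ∈ Submodule.span ℂ (range (@fourier T)),
      Tendsto (fun i => (∑ t ∈ P i, g (a t)) / ((P i).card : ℂ)) L
        (𝓝 (∫ x, g x ∂haarAddCircle)) := by
    intro g hg
    induction hg using Submodule.span_induction with
    | mem g hg =>
      obtain ⟨k, rfl⟩ := hg
      rw [integral_fourier]
      obtain ⟨p, rfl | rfl⟩ := k.eq_nat_or_neg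
      · obtain rfl | hp := p.eq_zero_or_pos
        · refine tendsto_const_nhds.congr' ?_
          filter_upwards [hP] with i hi
          have : ((P i).card : ℂ) ≠ 0 := by simpa using hi.ne_empty
          simp [this]
        · simpa [hp.ne'] using hW p hp
      · obtain rfl | hp := p.eq_zero_or_pos
        · refine tendsto_const_nhds.congr' ?_
          filter_upwards [hP] with i hi
          have : ((P i).card : ℂ) ≠ 0 := by simpa using hi.ne_empty
          simp [this]
        -- Negative frequencies follow from the positive ones by conjugation.
        · have h := (Complex.continuous_conj.tendsto 0).comp (hW p hp)
          simpa only [Function.comp_def, map_div₀, map_sum, map_natCast, map_zero, ← fourier_neg,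
            neg_eq_zero, Nat.cast_eq_zero, hp.ne', if_false] using h
    | zero => simpa using tendsto_const_nhds
    | add f g _ _ hf hg =>
      simp only [ContinuousMap.add_apply, Finset.sum_add_distrib, add_div]
      rw [integral_add (hinteg f) (hinteg g)]
      exact hf.add hg
    | smul c f _ hf =>
      simp only [ContinuousMap.smul_apply, smul_eq_mul, ← Finset.mul_sum, mul_div_assoc]
      rw [integral_const_mul]
      exact hf.const_mul c
  have hf : f ∈ closure (Submodule.span ℂ (range (@fourier T)) : Set C(AddCircle T, ℂ)) := by
    rw [← Submodule.topologicalClosure_coe, span_fourier_closure_eq_top]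
    trivial
  rw [Metric.tendsto_nhds]
  intro ε hε
  -- Trigonometric polynomials are uniformly dense; averages and integrals both change by at most
  -- the uniform distance.
  obtain ⟨g, hg, hfg⟩ := Metric.mem_closure_iff.1 hf (ε / 3) (by positivity)
  filter_upwards [Metric.tendsto_nhds.1 (hspan g hg) (ε / 3) (by positivity)] with i hi
  have h1 : dist ((∑ t ∈ P i, f (a t)) / ((P i).card : ℂ))
      ((∑ t ∈ P i, g (a t)) / ((P i).card : ℂ)) ≤ dist f g := by
    rw [dist_eq_norm, dist_eq_norm, ← sub_div, ← Finset.sum_sub_distrib]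
    exact norm_average_le i (f - g)
  have h2 : dist (∫ x, g x ∂(haarAddCircle (T := T))) (∫ x, f x ∂haarAddCircle) ≤ dist f g := by
    rw [dist_comm, dist_eq_norm, dist_eq_norm, ← integral_sub (hinteg f) (hinteg g)]
    refine (norm_integral_le_of_norm_le_const (C := ‖f - g‖)
      (ae_of_all _ fun x => (f - g).norm_coe_le_norm x)).trans ?_
    simp
  have h3 := dist_triangle4 ((∑ t ∈ P i, f (a t)) / ((P i).card : ℂ))
    ((∑ t ∈ P i, g (a t)) / ((P i).card : ℂ)) (∫ x, g x ∂haarAddCircle)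
    (∫ x, f x ∂haarAddCircle)
  linarith

open Classical in
/-- The uniform distribution on the points `a t`, `t ∈ F`; a point mass if `F` is empty. -/
noncomputable def empiricalMeasure (a : α → AddCircle T) (F : Finset α) :
    Measure (AddCircle T) :=
  if F.Nonempty then ∑ t ∈ F, ((F.card : ENNReal))⁻¹ • Measure.dirac (a t) else Measure.dirac 0

instance {T : ℝ} {a : α → AddCircle T} (F : Finset α) : IsProbabilityMeasure (empiricalMeasure a F) := by
  rw [empiricalMeasure]
  split_ifs with hF
  · constructor
    have h0 : (F.card : ENNReal) ≠ 0 := by simpa using hF.ne_empty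
    simp [ENNReal.mul_inv_cancel h0 (ENNReal.natCast_ne_top _)]
  · infer_instance

/-- The uniform distribution on the points `a t`, `t ∈ F`, as a probability measure. -/
noncomputable def empirical (a : α → AddCircle T) (F : Finset α) :
    ProbabilityMeasure (AddCircle T) :=
  ⟨empiricalMeasure a F, inferInstance⟩

/-- The normalized Haar measure of the circle as a probability measure. -/
noncomputable def haarProbability (T : ℝ) [Fact (0 < T)] : ProbabilityMeasure (AddCircle T) :=
  ⟨haarAddCircle, inferInstance⟩

theorem coe_haarProbability : (haarProbability T : Measure (AddCircle T)) = haarAddCircle := rfl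

theorem coe_empirical {T : ℝ} {a : α → AddCircle T} {F : Finset α} (hF : F.Nonempty) :
    (empirical a F : Measure (AddCircle T)) =
      ∑ t ∈ F, ((F.card : ENNReal))⁻¹ • Measure.dirac (a t) :=
  if_pos hF

open Classical in
theorem empirical_real {T : ℝ} {a : α → AddCircle T} {F : Finset α} (hF : F.Nonempty) {E : Set (AddCircle T)}
    (hE : MeasurableSet E) :
    (empirical a F : Measure (AddCircle T)).real E =
      ((F.filter fun t => a t ∈ E).card : ℝ) / F.card := by
  rw [coe_empirical hF, Measure.real, Measure.finsetSum_apply]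
  simp only [Measure.smul_apply, Measure.dirac_apply' _ hE, smul_eq_mul]
  rw [← Finset.mul_sum]
  simp [indicator_apply, Finset.sum_boole, div_eq_inv_mul]

theorem integral_empirical {F : Finset α} (hF : F.Nonempty) (f : C(AddCircle T, ℝ)) :
    ∫ x, f x ∂(empirical a F : Measure (AddCircle T)) = (∑ t ∈ F, f (a t)) / F.card := by
  rw [coe_empirical hF, integral_finsetSum_measure]
  · simp only [integral_smul_measure, integral_dirac]
    rw [← Finset.smul_sum]
    simp [div_eq_inv_mul]
  · intro t _
    refine Integrable.smul_measure ?_ (by simpa using hF.ne_empty)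
    exact f.continuous.integrable_of_hasCompactSupport (HasCompactSupport.of_compactSpace _)

/-- Weak convergence is tested on real functions, whereas exponential sums handle complex ones;
hence the detour through a complexified function and real parts. -/
theorem tendsto_empirical (hP : ∀ᶠ i in L, (P i).Nonempty)
    (hW : ∀ p : ℕ, 0 < p →
      Tendsto (fun i => (∑ t ∈ P i, fourier p (a t)) / ((P i).card : ℂ)) L (𝓝 0)) :
    Tendsto (fun i => empirical a (P i)) L (𝓝 (haarProbability T)) := by
  rw [ProbabilityMeasure.tendsto_iff_forall_integral_tendsto]
  intro f
  have h := tendsto_average hP hW ⟨fun x => (f x : ℂ), by fun_prop⟩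
  simp only [ContinuousMap.coe_mk, integral_complex_ofReal] at h
  rw [coe_haarProbability]
  have h' := (Complex.continuous_re.tendsto _).comp h
  simp only [Complex.ofReal_re] at h'
  refine h'.congr' ?_
  filter_upwards [hP] with i hi
  rw [show (fun x => f x) = f.toContinuousMap from rfl, integral_empirical hi]
  simp only [Function.comp_apply]
  norm_cast

theorem isClosed_coe_image_Icc {T : ℝ} (x y : ℝ) :
    IsClosed ((fun t : ℝ => (t : AddCircle T)) '' Icc x y) :=
  (isCompact_Icc.image (AddCircle.continuous_mk' T)).isClosed

theorem volume_coe_image_Icc {x y : ℝ} (hyx : y < x + T) :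
    volume ((fun t : ℝ => (t : AddCircle T)) '' Icc x y) = ENNReal.ofReal (y - x) := by
  rw [AddCircle.add_projection_respects_measure T (y - T)
    (isClosed_coe_image_Icc x y).measurableSet, ← Real.volume_Icc]
  congr 1
  -- The fundamental domain is half-open on the left and ends at `y`, so it contains the whole
  -- closed interval, including its right end.
  have hsub : Icc x y ⊆ Ioc (y - T) (y - T + T) := fun t ht =>
    ⟨by linarith [ht.1], by linarith [ht.2]⟩
  ext t
  constructor
  · rintro ⟨⟨u, hu, hut⟩, ht⟩
    rwa [← (AddCircle.coe_eq_coe_iff_of_mem_Ioc (hsub hu) ht).1 hut]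
  · exact fun ht => ⟨⟨t, ht, rfl⟩, hsub ht⟩

theorem haarAddCircle_eq (E : Set (AddCircle T)) :
    haarAddCircle E = (ENNReal.ofReal T)⁻¹ * volume E := by
  have hT0 : ENNReal.ofReal T ≠ 0 := by simpa using hT.out
  rw [volume_eq_smul_haarAddCircle, Measure.smul_apply, smul_eq_mul, ← mul_assoc,
    ENNReal.inv_mul_cancel hT0 ENNReal.ofReal_ne_top, one_mul]

theorem haarAddCircle_singleton (x : ℝ) : haarAddCircle {(x : AddCircle T)} = 0 := by
  have h := volume_coe_image_Icc (T := T) (x := x) (y := x) (by linarith [hT.out])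
  rw [Icc_self, image_singleton] at h
  rw [haarAddCircle_eq, h]
  simp

/-- The image of the open interval is open, so the frontier consists of at most the two endpoints.
This is the null-boundary condition of the portmanteau theorem. -/
theorem haarAddCircle_frontier (x y : ℝ) :
    haarAddCircle (frontier ((fun t : ℝ => (t : AddCircle T)) '' Icc x y)) = 0 := by
  have hsub : frontier ((fun t : ℝ => (t : AddCircle T)) '' Icc x y) ⊆ {(x : AddCircle T), ↑y} := by
    rw [(isClosed_coe_image_Icc x y).frontier_eq]
    rintro _ ⟨⟨t, ht, rfl⟩, hni⟩
    by_contra hne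
    simp only [mem_insert_iff, mem_singleton_iff, not_or] at hne
    refine hni (interior_maximal (image_mono Ioo_subset_Icc_self)
      (QuotientAddGroup.isOpenMap_coe _ isOpen_Ioo) ⟨t, ⟨?_, ?_⟩, rfl⟩)
    · exact lt_of_le_of_ne ht.1 fun h => hne.1 (by rw [h])
    · exact lt_of_le_of_ne ht.2 fun h => hne.2 (by rw [h])
  exact measure_mono_null hsub (measure_union_null (haarAddCircle_singleton x)
    (haarAddCircle_singleton y))

open Classical in
/-- Weyl's criterion for finite families of points in `[0, T)`. -/
theorem tendsto_card_filter_div (hP : ∀ᶠ i in L, (P i).Nonempty) {b : α → ℝ}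
    (hb : ∀ t, b t ∈ Ico 0 T)
    (hW : ∀ p : ℕ, 0 < p →
      Tendsto (fun i => (∑ t ∈ P i, fourier p (b t : AddCircle T)) / ((P i).card : ℂ)) L (𝓝 0))
    {x y : ℝ} (hx : 0 ≤ x) (hxy : x < y) (hy : y < T) :
    Tendsto (fun i => (((P i).filter fun t => b t ∈ Icc x y).card : ℝ) / (P i).card) L
      (𝓝 ((y - x) / T)) := by
  set E := (fun t : ℝ => (t : AddCircle T)) '' Icc x y with hE
  have h := ProbabilityMeasure.tendsto_measure_of_null_frontier_of_tendsto'
    (tendsto_empirical hP hW) (E := E)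
    (by rw [coe_haarProbability]; exact haarAddCircle_frontier x y)
  rw [coe_haarProbability] at h
  have h' := (ENNReal.tendsto_toReal (measure_ne_top _ _)).comp h
  have hval : (haarAddCircle E).toReal = (y - x) / T := by
    rw [haarAddCircle_eq, hE, volume_coe_image_Icc (by linarith), ENNReal.toReal_mul,
      ENNReal.toReal_inv, ENNReal.toReal_ofReal hT.out.le, ENNReal.toReal_ofReal (by linarith)]
    ring
  rw [← hval]
  refine h'.congr' ?_
  filter_upwards [hP] with i hi
  -- Since both `b t` and the interval lie in `[0, T)`, passing to the circle identifies no further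
  -- points.
  have hmem : ∀ t, (b t : AddCircle T) ∈ E ↔ b t ∈ Icc x y := by
    intro t
    constructor
    · rintro ⟨u, hu, hut⟩
      rwa [← (AddCircle.coe_eq_coe_iff_of_mem_Ico (a := 0) (p := T)
        (x := u) (y := b t) ⟨hx.trans hu.1, by linarith [hu.2]⟩ (by simpa using hb t)).1 hut]
    · exact fun ht => ⟨_, ht, rfl⟩
  refine (empirical_real hi (isClosed_coe_image_Icc x y).measurableSet).trans ?_
  simp only [← hE, hmem]

end Weyl

/-! ### Weyl's criterion for tile angles -/

theorem Tile.angle_mem {n : ℕ} (T : Tile n) : T.angle ∈ Ico 0 (2 * Real.pi) := by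
  have h := toIcoMod_mem_Ico Real.two_pi_pos 0 (Complex.arg (T.2.linearIsometryEquiv 1))
  rwa [zero_add] at h

theorem Tile.exp_angle {n : ℕ} (T : Tile n) : Complex.exp (T.angle * Complex.I) = T.dir := by
  have h1 := toIcoMod_add_toIcoDiv_zsmul Real.two_pi_pos 0 (Complex.arg T.dir)
  have h2 : Complex.exp (Complex.arg T.dir * Complex.I) = T.dir := by
    have := Complex.norm_mul_exp_arg_mul_I T.dir
    rwa [T.norm_dir, Complex.ofReal_one, one_mul] at this
  conv_rhs => rw [← h2, ← h1]
  rw [show T.angle = toIcoMod Real.two_pi_pos 0 (Complex.arg T.dir) from rfl]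
  refine Complex.exp_eq_exp_iff_exists_int.2
    ⟨-toIcoDiv Real.two_pi_pos 0 (Complex.arg T.dir), ?_⟩
  push_cast [zsmul_eq_mul]
  ring

theorem fourier_angle {n : ℕ} (p : ℕ) (T : Tile n) :
    fourier p (T.angle : AddCircle (2 * Real.pi)) = T.dir ^ p := by
  rw [fourier_coe_apply, ← T.exp_angle, ← Complex.exp_nat_mul]
  congr 1
  have : (Real.pi : ℂ) ≠ 0 := by exact_mod_cast Real.pi_ne_zero
  push_cast
  field_simp

/-- Weyl's criterion for the angles of finite sets of tiles. -/
theorem tendsto_ncard_angle_div {ι : Type*} {L : Filter ι} {n : ℕ} {P : ι → Set (Tile n)}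
    (hfin : ∀ i, (P i).Finite) (hpos : ∀ᶠ i in L, 0 < (P i).ncard)
    (hW : ∀ p : ℕ, 0 < p → ∀ ε > 0, ∀ᶠ i in L, ‖weylSum p (P i)‖ ≤ ε * (P i).ncard)
    {x y : ℝ} (hx : 0 ≤ x) (hxy : x < y) (hy : y < 2 * Real.pi) :
    Tendsto (fun i => (({T ∈ P i | T.angle ∈ Icc x y}).ncard : ℝ) / ((P i).ncard : ℝ)) L
      (𝓝 ((y - x) / (2 * Real.pi))) := by
  classical
  have : Fact (0 < 2 * Real.pi) := ⟨Real.two_pi_pos⟩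
  have hP : ∀ᶠ i in L, (hfin i).toFinset.Nonempty := by
    filter_upwards [hpos] with i hi
    rw [ncard_eq_toFinset_card _ (hfin i)] at hi
    exact Finset.card_pos.1 hi
  have h := tendsto_card_filter_div (T := 2 * Real.pi) (P := fun i => (hfin i).toFinset) hP
    (b := Tile.angle) Tile.angle_mem ?_ hx hxy hy
  · refine h.congr fun i => ?_
    rw [ncard_eq_toFinset_card _ (hfin i),
      ncard_eq_toFinset_card _ ((hfin i).subset (sep_subset _ _))]
    congr 3
    ext T
    simp only [Finset.mem_filter, Finite.mem_toFinset, mem_ofPred_eq]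
  · intro p hp
    rw [Metric.tendsto_nhds]
    intro ε hε
    filter_upwards [hW p hp (ε / 2) (by positivity), hpos] with i hi hi0
    have hi0' : (0 : ℝ) < (P i).ncard := by exact_mod_cast hi0
    simp only [fourier_angle]
    rw [dist_zero_right, ← finsum_mem_eq_finite_toFinset_sum _ (hfin i), norm_div,
      Complex.norm_natCast, ← ncard_eq_toFinset_card _ (hfin i), div_lt_iff₀ hi0']
    refine lt_of_le_of_lt hi ?_
    nlinarith

/-! ### From small exponential sums to statistical circular symmetry -/

namespace Substitution

variable {n : ℕ} {s : Substitution n}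

theorem IsPacking.hasStatisticalCircularSymmetry (hs : s.IsPacking)
    (hprim : s.matrix.IsPrimitive)
    (hW : ∀ p : ℕ, 0 < p → ∀ ε > 0, ∃ k₀, ∀ k ≥ k₀, ∀ i,
      ‖weylSum p (s.supertile k i)‖ ≤ ε * (s.supertile k i).ncard)
    {𝒯 : Set (Tile n)} (h𝒯 : s.IsSubstitutionTiling 𝒯) :
    s.HasStatisticalCircularSymmetry 𝒯 where
  primitive := hprim
  of_balls x y hx hxy hy := by
    have h := tendsto_ncard_angle_div (P := fun r => IsPacking.ballTiles s 𝒯 r)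
      (hs.finite_ballTiles h𝒯.isTiling) (hs.eventually_card_ballTiles_pos h𝒯.isTiling)
      (fun p hp => hs.eventually_norm_weylSum_ballTiles_le h𝒯 (hW p hp)) hx hxy hy
    refine h.congr fun r => ?_
    simp only [IsPacking.ballTiles, mem_ofPred_eq, and_assoc]
  of_supertiles e he _ _ x y hx hxy hy := by
    have hcard : ∀ l : ℕ, (e '' Iio l).ncard = l := fun l => by
      rw [ncard_image_of_injective _ he, ncard_eq_toFinset_card']
      simp
    have h := tendsto_ncard_angle_div (L := atTop ⊓ 𝓟 {l : ℕ | s.IsSupertile (e '' Iio l)})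
      (P := fun l : ℕ => e '' Iio l) (fun l => (finite_Iio l).image e) ?_ ?_ hx hxy hy
    · refine h.congr fun l => ?_
      classical
      rw [hcard, one_div_mul_eq_div]
      congr 1
      have hset : {T ∈ e '' Iio l | T.angle ∈ Icc x y} =
          e '' ((Finset.range l).filter fun k => (e k).angle ∈ Icc x y : Finset ℕ) := by
        ext T
        simp only [mem_ofPred_eq, mem_image, Finset.coe_filter, Finset.mem_range, mem_Iio]
        constructor
        · rintro ⟨⟨k, hk, rfl⟩, hT⟩
          exact ⟨k, ⟨hk, hT⟩, rfl⟩
        · rintro ⟨k, ⟨hk, hT⟩, rfl⟩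
          exact ⟨⟨k, hk, rfl⟩, hT⟩
      rw [hset, ncard_image_of_injective _ he, ncard_coe_finset, Finset.card_filter]
      push_cast
      refine Finset.sum_congr rfl fun k _ => ?_
      simp [indicator_apply]
    · refine Eventually.filter_mono inf_le_left ?_
      filter_upwards [eventually_gt_atTop 0] with l hl
      rwa [hcard]
    · intro p hp ε hε
      obtain ⟨k₀, hk₀⟩ := hW p hp ε hε
      -- An initial segment that is a supertile with more than `N` tiles has order at least `k₀`,
      -- where the bound on supertiles applies.
      obtain ⟨N, hN⟩ := s.exists_order_bound k₀
      rw [eventually_inf_principal]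
      filter_upwards [eventually_gt_atTop N] with l hl
      rintro ⟨k, i, g, hg⟩
      have hc := hcard l
      rw [hg] at hc ⊢
      rw [norm_weylSum_move p (hs.finite_supertile k i)]
      rw [ncard_image_of_injective _ (Tile.move_injective g)] at hc ⊢
      exact hk₀ k (hN k i (by rwa [hc])) i

end Substitution

/-! ### Lengths and angles of the prototiles -/

section Factor

variable {m j : ℕ} (hjm : j < m)

theorem factor_spec : 0 < pythagorasFactor hjm ∧
    pythagorasFactor hjm ^ (2 * m) = pythagorasFactor hjm ^ (2 * j) + 1 :=
  (existsUnique_factor hjm).choose_spec.1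

theorem factor_pos : 0 < pythagorasFactor hjm := (factor_spec hjm).1

theorem one_lt_factor : 1 < pythagorasFactor hjm := by
  by_contra! hle
  have h1 := pow_le_one₀ (n := 2 * m) (factor_pos hjm).le hle
  have h2 : 0 < pythagorasFactor hjm ^ (2 * j) := pow_pos (factor_pos hjm) _
  linarith [(factor_spec hjm).2]

theorem shortLeg_pos : 0 < shortLeg hjm := inv_pos.2 (pow_pos (factor_pos hjm) _)

theorem factor_pow_mul_shortLeg : pythagorasFactor hjm ^ m * shortLeg hjm = 1 :=
  mul_inv_cancel₀ (pow_pos (factor_pos hjm) _).ne'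

theorem shortLeg_lt_one : shortLeg hjm < 1 :=
  inv_lt_one_of_one_lt₀ (one_lt_pow₀ (one_lt_factor hjm) (by omega))

/-- This is the equation λ^(2m) = λ^(2j) + 1 divided by λ^(2m). -/
theorem longLeg_eq : longLeg hjm = pythagorasFactor hjm ^ j * shortLeg hjm := by
  rw [longLeg, Real.sqrt_eq_iff_mul_self_eq_of_pos
    (mul_pos (pow_pos (factor_pos hjm) _) (shortLeg_pos hjm))]
  have h1 := (factor_spec hjm).2
  have h2 := factor_pow_mul_shortLeg hjm
  rw [mul_comm 2 m, mul_comm 2 j, pow_mul, pow_mul] at h1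
  have h3 : (pythagorasFactor hjm ^ m) ^ 2 * shortLeg hjm ^ 2 = 1 := by
    rw [← mul_pow, h2, one_pow]
  linear_combination (-shortLeg hjm ^ 2) * h1 + h3

theorem longLeg_pos : 0 < longLeg hjm := by
  rw [longLeg_eq]
  exact mul_pos (pow_pos (factor_pos hjm) _) (shortLeg_pos hjm)

theorem shortLeg_sq_add : shortLeg hjm ^ 2 + longLeg hjm ^ 2 = 1 := by
  have : shortLeg hjm ^ 2 ≤ 1 := pow_le_one₀ (shortLeg_pos hjm).le (shortLeg_lt_one hjm).le
  rw [longLeg, Real.sq_sqrt (by linarith)]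
  ring

theorem factor_pow_mul_longLeg :
    pythagorasFactor hjm ^ m * longLeg hjm = pythagorasFactor hjm ^ j := by
  rw [longLeg_eq, mul_left_comm, factor_pow_mul_shortLeg, mul_one]

/-- The long leg of T_{j+1} equals the width of the rectangle whose diagonal is switched; its height
is the short leg λ^j a = b. -/
theorem factor_pow_j_mul_longLeg :
    pythagorasFactor hjm ^ j * longLeg hjm = pythagorasFactor hjm ^ m - shortLeg hjm := by
  have h1 := shortLeg_sq_add hjm
  have h2 := factor_pow_mul_shortLeg hjm
  have h3 := factor_pow_mul_longLeg hjm
  linear_combination (-longLeg hjm) * h3 + pythagorasFactor hjm ^ m * h1 - shortLeg hjm * h2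

theorem exp_theta :
    Complex.exp (theta hjm * Complex.I) = shortLeg hjm + longLeg hjm * Complex.I := by
  rw [Complex.exp_mul_I, ← Complex.ofReal_cos, ← Complex.ofReal_sin, theta,
    Real.cos_arccos (by linarith [shortLeg_pos hjm]) (shortLeg_lt_one hjm).le, Real.sin_arccos,
    longLeg]

theorem exp_neg_theta :
    Complex.exp ((-theta hjm : ℝ) * Complex.I) = shortLeg hjm - longLeg hjm * Complex.I := by
  have h := congrArg (starRingEnd ℂ) (exp_theta hjm)
  rw [← Complex.exp_conj] at h
  simp only [map_mul, map_add, Complex.conj_ofReal, Complex.conj_I] at h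
  rw [Complex.ofReal_neg, neg_mul, ← mul_neg, h]
  ring

theorem exp_half_pi : Complex.exp ((Real.pi / 2 : ℝ) * Complex.I) = Complex.I := by
  push_cast
  exact Complex.exp_pi_div_two_mul_I

theorem exp_neg_half_pi : Complex.exp ((-(Real.pi / 2) : ℝ) * Complex.I) = -Complex.I := by
  rw [← neg_div]
  push_cast
  exact Complex.exp_neg_pi_div_two_mul_I

theorem exp_neg_theta_sub :
    Complex.exp ((-theta hjm - Real.pi / 2 : ℝ) * Complex.I) =
      -(longLeg hjm : ℂ) - shortLeg hjm * Complex.I := by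
  rw [sub_eq_add_neg, Complex.ofReal_add, add_mul, Complex.exp_add, exp_neg_theta,
    exp_neg_half_pi]
  linear_combination (longLeg hjm : ℂ) * Complex.I_mul_I

end Factor

/-! ### Triangles as convex hulls and separating lines -/

section Hull

theorem mem_convexHull_triple {x y z : ℂ} {α β γ : ℝ} (hα : 0 ≤ α) (hβ : 0 ≤ β) (hγ : 0 ≤ γ)
    (h : α + β + γ = 1) : (α : ℂ) * x + β * y + γ * z ∈ convexHull ℝ {x, y, z} := by
  have hmem := (convex_convexHull ℝ {x, y, z}).sum_mem (t := Finset.univ)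
    (w := ![α, β, γ]) (z := ![x, y, z]) ?_ ?_ ?_
  · simpa [Fin.sum_univ_three] using hmem
  · intro i _
    fin_cases i <;> simpa
  · simpa [Fin.sum_univ_three] using h
  · intro i _
    refine subset_convexHull ℝ _ ?_
    fin_cases i <;> simp

theorem isLinearMap_re_im (α β : ℝ) : IsLinearMap ℝ fun z : ℂ => α * z.re + β * z.im :=
  ⟨fun x y => by simp; ring, fun c x => by simp; ring⟩

/-- Convex hulls that are separated by a line have disjoint interiors. -/
theorem disjoint_interior_convexHull {α β c : ℝ} (hne : 0 < α ^ 2 + β ^ 2) {X Y : Set ℂ}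
    (hX : ∀ z ∈ X, α * z.re + β * z.im ≤ c) (hY : ∀ z ∈ Y, c ≤ α * z.re + β * z.im) :
    Disjoint (interior (convexHull ℝ X)) (interior (convexHull ℝ Y)) := by
  have hX' : convexHull ℝ X ⊆ {z : ℂ | α * z.re + β * z.im ≤ c} :=
    convexHull_min hX (convex_halfSpace_le (isLinearMap_re_im α β) c)
  have hY' : convexHull ℝ Y ⊆ {z : ℂ | c ≤ α * z.re + β * z.im} :=
    convexHull_min hY (convex_halfSpace_ge (isLinearMap_re_im α β) c)
  rw [Set.disjoint_left]
  intro z hzX hzY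
  -- A common interior point can be pushed slightly along the normal (α, β), which leaves the
  -- half-plane containing `X`.
  have hcont : Tendsto (fun ε : ℝ => z + (ε : ℂ) * ⟨α, β⟩) (𝓝[>] 0) (𝓝 z) := by
    have : Continuous fun ε : ℝ => z + (ε : ℂ) * ⟨α, β⟩ := by fun_prop
    simpa using (this.tendsto 0).mono_left nhdsWithin_le_nhds
  obtain ⟨ε, hε, hε0⟩ := ((hcont.eventually (isOpen_interior.mem_nhds hzX)).and
    self_mem_nhdsWithin).exists
  have h1 := hX' (interior_subset hε)
  have h2 := hY' (interior_subset hzY)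
  simp only [mem_ofPred_eq, Complex.add_re, Complex.add_im, Complex.re_ofReal_mul,
    Complex.im_ofReal_mul] at h1 h2
  have h3 := mul_pos (show (0 : ℝ) < ε from hε0) hne
  nlinarith

end Hull

/-! ### The Pythagoras substitution is a packing -/

section Pythagoras

open Substitution
open scoped Pointwise

variable {m j : ℕ} (hjm : j < m)

theorem triangle_eq (i : Fin m) :
    triangle hjm i = convexHull ℝ {0, -((pythagorasFactor hjm : ℂ) ^ (i : ℕ) * shortLeg hjm),
      (pythagorasFactor hjm : ℂ) ^ (i : ℕ) * apex hjm} := by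
  have h := (LinearMap.mulLeft ℝ ((pythagorasFactor hjm : ℂ) ^ (i : ℕ))).image_convexHull
    {0, -(shortLeg hjm : ℂ), apex hjm}
  rw [image_insert_eq, image_pair] at h
  change (LinearMap.mulLeft ℝ ((pythagorasFactor hjm : ℂ) ^ (i : ℕ))) '' _ = _
  rw [h]
  simp

theorem support_eq (i : Fin m) (g : Motion) :
    (pythagoras hjm).support (i, g) = convexHull ℝ
      {g 0, g (-((pythagorasFactor hjm : ℂ) ^ (i : ℕ) * shortLeg hjm)),
        g ((pythagorasFactor hjm : ℂ) ^ (i : ℕ) * apex hjm)} := by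
  have h := (g.toAffineEquiv : ℂ →ᵃ[ℝ] ℂ).image_convexHull
    {0, -((pythagorasFactor hjm : ℂ) ^ (i : ℕ) * shortLeg hjm),
      (pythagorasFactor hjm : ℂ) ^ (i : ℕ) * apex hjm}
  rw [image_insert_eq, image_pair] at h
  change g '' triangle hjm i = _
  rw [triangle_eq]
  exact h

theorem smul_triangle (c : ℝ) (i : Fin m) :
    c • triangle hjm i = convexHull ℝ
      {0, -(c * ((pythagorasFactor hjm : ℂ) ^ (i : ℕ) * shortLeg hjm)),
        c * ((pythagorasFactor hjm : ℂ) ^ (i : ℕ) * apex hjm)} := by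
  rw [triangle_eq, ← convexHull_smul, ← image_smul, image_insert_eq, image_pair]
  simp

theorem triangle_interior_nonempty (i : Fin m) : (interior (triangle hjm i)).Nonempty := by
  have ha := shortLeg_pos hjm
  have hb := longLeg_pos hjm
  -- The strict inequalities express that the point lies on the inner side of each of the three
  -- edges.
  set O : Set ℂ := {z | -shortLeg hjm < z.re ∧ 0 < z.im ∧
    shortLeg hjm * z.im + longLeg hjm * z.re < 0} with hO
  have hOpen : IsOpen O := by
    refine (isOpen_lt continuous_const Complex.continuous_re).inter
      ((isOpen_lt continuous_const Complex.continuous_im).inter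
        (isOpen_lt (((continuous_const (y := shortLeg hjm)).mul Complex.continuous_im).add
          ((continuous_const (y := longLeg hjm)).mul Complex.continuous_re)) continuous_const))
  have hsub : O ⊆ convexHull ℝ {0, -(shortLeg hjm : ℂ), apex hjm} := by
    rintro z ⟨h1, h2, h3⟩
    have hz : z = ((1 + z.re / shortLeg hjm : ℝ) : ℂ) * 0 +
        ((-(z.re / shortLeg hjm) - z.im / longLeg hjm : ℝ) : ℂ) * (-(shortLeg hjm : ℂ)) +
        ((z.im / longLeg hjm : ℝ) : ℂ) * apex hjm := by
      apply Complex.ext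
      · simp [apex]
        field_simp
        ring
      · simp [apex]
        field_simp
    rw [hz]
    refine mem_convexHull_triple ?_ ?_ (by positivity) (by ring)
    · rw [← neg_le_iff_add_nonneg', le_div_iff₀ ha]
      linarith
    · rw [← neg_div, div_sub_div _ _ ha.ne' hb.ne']
      exact div_nonneg (by linarith) (by positivity)
  have hinteg : (interior (convexHull ℝ {0, -(shortLeg hjm : ℂ), apex hjm})).Nonempty := by
    refine ⟨⟨-shortLeg hjm / 2, longLeg hjm / 4⟩,
      interior_maximal hsub hOpen ⟨?_, ?_, ?_⟩⟩
    · change -shortLeg hjm < -shortLeg hjm / 2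
      linarith
    · change 0 < longLeg hjm / 4
      linarith
    · change shortLeg hjm * (longLeg hjm / 4) + longLeg hjm * (-shortLeg hjm / 2) < 0
      nlinarith [mul_pos ha hb]
  have h : triangle hjm i = (pythagorasFactor hjm ^ (i : ℕ)) •
      convexHull ℝ {0, -(shortLeg hjm : ℂ), apex hjm} := by
    rw [triangle, ← image_smul]
    simp
  rw [h, interior_smul₀ (pow_pos (factor_pos hjm) _).ne']
  exact hinteg.smul_set

/-- The small tile in the dissection of the largest enlarged prototile. -/
noncomputable def phiTile : Tile m := (⟨0, by omega⟩, mirror (-theta hjm) 0)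

/-- The large tile in the dissection of the largest enlarged prototile. -/
noncomputable def psiTile : Tile m := (⟨j, hjm⟩, mirror (-theta hjm - Real.pi / 2) (-1))

theorem support_phiTile : (pythagoras hjm).support (phiTile hjm) =
    convexHull ℝ {0, (shortLeg hjm : ℂ) * apex hjm, -1} := by
  have h := congrArg (fun x : ℝ => (x : ℂ)) (shortLeg_sq_add hjm)
  push_cast at h
  rw [phiTile, support_eq]
  congr 2
  · simp [mirror_apply]
  congr 1
  · simp only [mirror_apply, exp_neg_theta, pow_zero, one_mul, map_neg, Complex.conj_ofReal, apex]
    ring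
  congr 1
  simp only [mirror_apply, exp_neg_theta, pow_zero, one_mul, map_neg, Complex.conj_ofReal, apex,
    map_add, map_mul, Complex.conj_I]
  linear_combination -h + (longLeg hjm : ℂ) ^ 2 * Complex.I_sq

theorem support_psiTile : (pythagoras hjm).support (psiTile hjm) =
    convexHull ℝ {-1, (shortLeg hjm : ℂ) * apex hjm,
      -1 + (pythagorasFactor hjm : ℂ) ^ j * Complex.I} := by
  have h := congrArg (fun x : ℝ => (x : ℂ)) (shortLeg_sq_add hjm)
  have h' := congrArg (fun x : ℝ => (x : ℂ)) (longLeg_eq hjm)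
  push_cast at h h'
  rw [psiTile, support_eq]
  congr 2
  · simp [mirror_apply]
  congr 1
  · simp only [mirror_apply, exp_neg_theta_sub, ← h', map_neg, Complex.conj_ofReal, apex]
    linear_combination h
  congr 1
  simp only [mirror_apply, exp_neg_theta_sub, apex, map_neg, Complex.conj_ofReal, map_pow,
    map_add, map_mul, Complex.conj_I]
  linear_combination (pythagorasFactor hjm : ℂ) ^ j * Complex.I * h +
    (pythagorasFactor hjm : ℂ) ^ j * shortLeg hjm * longLeg hjm * Complex.I_sq

theorem rule_of_lt {i : Fin m} (h : (i : ℕ) + 1 < m) :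
    (pythagoras hjm).rule i = {(⟨i + 1, h⟩, 1)} := dif_pos h

theorem rule_of_not_lt {i : Fin m} (h : ¬(i : ℕ) + 1 < m) :
    (pythagoras hjm).rule i = {phiTile hjm, psiTile hjm} := dif_neg h

theorem disjoint_interior_phiTile_psiTile :
    Disjoint (interior ((pythagoras hjm).support (phiTile hjm)))
      (interior ((pythagoras hjm).support (psiTile hjm))) := by
  have ha := shortLeg_pos hjm
  have hb := longLeg_pos hjm
  have hab := shortLeg_sq_add hjm
  rw [support_phiTile, support_psiTile]
  -- The separating line is the altitude, through -1 and its foot a · apex.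
  refine disjoint_interior_convexHull (α := -shortLeg hjm) (β := longLeg hjm)
    (c := shortLeg hjm) (by nlinarith) ?_ ?_
  · rintro z (rfl | rfl | rfl)
    · simp [ha.le]
    · simp [apex]
      nlinarith
    · simp
  · rintro z (rfl | rfl | rfl)
    · simp
    · simp [apex]
      nlinarith
    · have := mul_pos hb (pow_pos (factor_pos hjm) j)
      simp [← Complex.ofReal_pow]
      exact this.le

theorem pythagoras_isPacking : (pythagoras hjm).IsPacking where
  factor_pos := factor_pos hjm
  convex i := by
    change Convex ℝ (triangle hjm i)
    rw [triangle_eq]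
    exact convex_convexHull ℝ _
  compact i := by
    change IsCompact (triangle hjm i)
    rw [triangle_eq]
    exact (toFinite _).isCompact_convexHull ℝ
  interior_nonempty := triangle_interior_nonempty hjm
  rule_finite i := by
    by_cases h : (i : ℕ) + 1 < m
    · rw [rule_of_lt hjm h]
      exact finite_singleton _
    · rw [rule_of_not_lt hjm h]
      exact toFinite _
  rule_packs i := by
    by_cases h : (i : ℕ) + 1 < m
    · rw [rule_of_lt hjm h]
      exact packs_singleton _
    · rw [rule_of_not_lt hjm h]
      exact pairwise_pair.2 fun _ => ⟨disjoint_interior_phiTile_psiTile hjm,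
        (disjoint_interior_phiTile_psiTile hjm).symm⟩
  rule_subset i T hT := by
    change _ ⊆ pythagorasFactor hjm • triangle hjm i
    rw [smul_triangle]
    by_cases h : (i : ℕ) + 1 < m
    · rw [rule_of_lt hjm h, mem_singleton_iff] at hT
      rw [hT, support_eq]
      simp [pow_succ', mul_assoc]
    · rw [rule_of_not_lt hjm h] at hT
      have hi : (i : ℕ) = m - 1 := by omega
      have hpow : (pythagorasFactor hjm : ℂ) * (pythagorasFactor hjm : ℂ) ^ (i : ℕ) =
          (pythagorasFactor hjm : ℂ) ^ m := by
        rw [hi, ← pow_succ']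
        congr 1
        omega
      have h1 := congrArg (fun x : ℝ => (x : ℂ)) (factor_pow_mul_shortLeg hjm)
      have h2 := congrArg (fun x : ℝ => (x : ℂ)) (factor_pow_mul_longLeg hjm)
      have h3 := congrArg (fun x : ℝ => (x : ℂ)) (longLeg_eq hjm)
      push_cast at h1 h2 h3
      have hap : (pythagorasFactor hjm : ℂ) ^ m * apex hjm =
          -1 + (pythagorasFactor hjm : ℂ) ^ j * Complex.I := by
        rw [apex]
        linear_combination (-1 : ℂ) * h1 + Complex.I * h2
      rw [← mul_assoc, ← mul_assoc, hpow, h1, hap]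
      have ha := shortLeg_pos hjm
      have ha1 := shortLeg_lt_one hjm
      have hmem : (shortLeg hjm : ℂ) * apex hjm ∈ convexHull ℝ
          {0, -1, -1 + (pythagorasFactor hjm : ℂ) ^ j * Complex.I} := by
        -- The foot of the altitude divides the hypotenuse in the ratio a² : 1 - a².
        have := mem_convexHull_triple (x := 0) (y := -1)
          (z := -1 + (pythagorasFactor hjm : ℂ) ^ j * Complex.I)
          (α := 1 - shortLeg hjm ^ 2) (β := 0) (γ := shortLeg hjm ^ 2) (by nlinarith) le_rfl
          (by positivity) (by ring)
        convert this using 1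
        rw [apex]
        push_cast
        linear_combination (shortLeg hjm : ℂ) * Complex.I * h3
      have hsub := subset_convexHull ℝ
        {0, -1, -1 + (pythagorasFactor hjm : ℂ) ^ j * Complex.I}
      obtain rfl | rfl := hT
      · rw [support_phiTile]
        refine convexHull_min ?_ (convex_convexHull ℝ _)
        rintro z (rfl | rfl | rfl)
        · exact hsub (by simp)
        · exact hmem
        · exact hsub (by simp)
      · rw [support_psiTile]
        refine convexHull_min ?_ (convex_convexHull ℝ _)
        rintro z (rfl | rfl | rfl)
        · exact hsub (by simp)
        · exact hmem
        · exact hsub (by simp)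

end Pythagoras

/-! ### The angle θ is incommensurable with π -/

/-- If `exp (i φ)` is a root of unity and `cos φ` is an algebraic integer, then `cos φ` is zero or
a root of unity. -/
theorem exists_cos_pow_eq_one {ζ : ℂ} {n : ℕ} (hn : 0 < n) (hζ : ζ ^ n = 1)
    (hinteg : IsIntegral ℤ ((ζ + ζ⁻¹) / 2)) (h0 : (ζ + ζ⁻¹) / 2 ≠ 0) :
    ∃ k, 0 < k ∧ ((ζ + ζ⁻¹) / 2) ^ k = 1 := by
  have hζint : IsIntegral ℚ ζ := by
    refine ⟨Polynomial.X ^ n - 1, Polynomial.monic_X_pow_sub_C 1 hn.ne', ?_⟩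
    simp [hζ]
  let K := IntermediateField.adjoin ℚ {ζ}
  have hfd : FiniteDimensional ℚ K := IntermediateField.adjoin.finiteDimensional hζint
  have hK : NumberField K := ⟨⟩
  let z : K := ⟨ζ, IntermediateField.mem_adjoin_simple_self ℚ ζ⟩
  let c : K := (z + z⁻¹) / 2
  have hc : (c : ℂ) = (ζ + ζ⁻¹) / 2 := by
    simp only [c, z, IntermediateField.coe_div, IntermediateField.coe_add,
      IntermediateField.coe_inv]
    rfl
  have hz : z ^ n = 1 := by
    apply Subtype.ext
    simpa [z] using hζ
  have hcint : IsIntegral ℤ c := by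
    rw [← isIntegral_algebraMap_iff (B := ℂ) (algebraMap K ℂ).injective]
    rwa [show algebraMap K ℂ c = (c : ℂ) from rfl, hc]
  have hc0 : c ≠ 0 := fun h => h0 (by rw [← hc, h]; simp)
  -- Kronecker's theorem: every embedding sends ζ to the unit circle, so all conjugates of (ζ +
  -- ζ⁻¹)/2 have modulus at most 1.
  obtain ⟨k, hk, hck⟩ := NumberField.Embeddings.pow_eq_one_of_norm_le_one K ℂ hc0 hcint fun φ => by
    have h1 : ‖φ z‖ = 1 := by
      refine Complex.norm_eq_one_of_pow_eq_one (n := n) ?_ hn.ne'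
      rw [← map_pow, hz, map_one]
    have h2 : ‖φ z + (φ z)⁻¹‖ ≤ 2 := by
      refine (norm_add_le _ _).trans ?_
      rw [norm_inv, h1]
      norm_num
    simp only [c, map_div₀, map_add, map_inv₀, map_ofNat, norm_div]
    rw [div_le_one (by simp)]
    simpa using h2
  refine ⟨k, hk, ?_⟩
  rw [← hc]
  exact_mod_cast congrArg (fun x : K => (x : ℂ)) hck

/-- λ⁻¹ is a root of X^(2m) + X^(2(m-j)) - 1, the defining equation divided by λ^(2m); this is monic
of degree 2m because j ≥ 1. Then a is a power of λ⁻¹. -/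
theorem isIntegral_shortLeg {m j : ℕ} (hj : 1 ≤ j) (hjm : j < m) : IsIntegral ℤ (shortLeg hjm : ℂ) := by
  have hpos := factor_pos hjm
  have h : IsIntegral ℤ ((pythagorasFactor hjm : ℂ)⁻¹) := by
    refine ⟨Polynomial.X ^ (2 * m) + (Polynomial.X ^ (2 * (m - j)) - 1), ?_, ?_⟩
    · refine Polynomial.monic_X_pow_add ?_
      refine lt_of_le_of_lt (Polynomial.degree_sub_le _ _) ?_
      rw [Polynomial.degree_X_pow, Polynomial.degree_one, max_lt_iff]
      exact ⟨by exact_mod_cast (by omega : 2 * (m - j) < 2 * m), by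
        exact_mod_cast (by omega : 0 < 2 * m)⟩
    · have h1 := (factor_spec hjm).2
      have h2 : (pythagorasFactor hjm : ℂ) ≠ 0 := by exact_mod_cast hpos.ne'
      have h3 : (pythagorasFactor hjm : ℂ) ^ (2 * m) = pythagorasFactor hjm ^ (2 * j) + 1 := by
        exact_mod_cast h1
      have h4 : (pythagorasFactor hjm : ℂ) ^ (2 * m) =
          pythagorasFactor hjm ^ (2 * j) * pythagorasFactor hjm ^ (2 * (m - j)) := by
        rw [← pow_add]
        congr 1
        omega
      simp only [Polynomial.eval₂_add, Polynomial.eval₂_sub, Polynomial.eval₂_X_pow,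
        Polynomial.eval₂_one, inv_pow]
      have h5 := pow_ne_zero (2 * j) h2
      have h6 := pow_ne_zero (2 * (m - j)) h2
      rw [h4] at h3 ⊢
      field_simp
      linear_combination -h3
  have : (shortLeg hjm : ℂ) = (pythagorasFactor hjm : ℂ)⁻¹ ^ m := by
    simp [shortLeg]
  rw [this]
  exact h.pow m

/-- The angle `theta` is not a rational multiple of `π`. -/
theorem exp_theta_pow_ne_one {m j : ℕ} (hj : 1 ≤ j) (hjm : j < m) {n : ℕ} (hn : 0 < n) :
    Complex.exp (theta hjm * Complex.I) ^ n ≠ 1 := by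
  intro h
  have hcos : (Complex.exp (theta hjm * Complex.I) +
      (Complex.exp (theta hjm * Complex.I))⁻¹) / 2 = shortLeg hjm := by
    rw [← Complex.exp_neg, ← neg_mul, ← Complex.ofReal_neg, exp_neg_theta, exp_theta]
    ring
  have ha := shortLeg_pos hjm
  obtain ⟨k, hk, hck⟩ := exists_cos_pow_eq_one hn h (hcos ▸ isIntegral_shortLeg hj hjm)
    (by rw [hcos]; exact_mod_cast ha.ne')
  rw [hcos] at hck
  have h1 : shortLeg hjm ^ k = 1 := by exact_mod_cast hck
  exact absurd h1 (pow_lt_one₀ ha.le (shortLeg_lt_one hjm) hk.ne').ne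

/-! ### Composition of mirrors; substitution matrix and occurrence of types -/

theorem dilate_mirror (c φ : ℝ) (t : ℂ) : dilate c (mirror φ t) = mirror φ (c * t) := by
  refine motion_ext (fun z => ?_) ?_
  · rw [linear_dilate, linear_mirror, linear_mirror]
  · rw [dilate_apply_zero, mirror_apply, mirror_apply]
    simp

theorem mirror_mul_mirror (φ φ' : ℝ) (t t' : ℂ) :
    mirror φ t * mirror φ' t' =
      rot (φ - φ') (Complex.exp (φ * Complex.I) * (starRingEnd ℂ) t' + t) := by
  refine motion_ext (fun z => ?_) ?_
  · rw [linear_mul, linear_mirror, linear_mirror, linear_rot, map_mul, Complex.conj_conj,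
      ← Complex.exp_conj, ← mul_assoc, ← Complex.exp_add]
    simp only [map_mul, Complex.conj_ofReal, Complex.conj_I]
    push_cast
    ring_nf
  · rw [AffineIsometryEquiv.coe_mul, Function.comp_apply, mirror_apply, mirror_apply, rot_apply]
    simp

theorem rot_zero_zero : rot 0 0 = 1 := by
  refine motion_ext (fun z => ?_) ?_
  · rw [linear_rot, linear_one]
    simp
  · rw [rot_apply]
    simp

namespace Substitution

variable {n : ℕ} {s : Substitution n}

open scoped Pointwise in
theorem IsPacking.exists_support_subset_of_mem_iterate (hs : s.IsPacking) {k : ℕ}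
    {P : Set (Tile n)} {t : Tile n} (ht : t ∈ s.apply^[k] P) :
    ∃ T ∈ P, s.support t ⊆ s.factor ^ k • s.support T := by
  rw [iterate_apply_eq] at ht
  obtain ⟨T, hT, t', ht', rfl⟩ := mem_iUnion₂.1 ht
  refine ⟨T, hT, ?_⟩
  rw [support_move, show s.support T = T.2 '' s.proto T.1 from rfl, ← dilate_image_smul]
  exact image_mono (hs.support_subset_of_mem_supertile ht')

theorem move_mem_iterate {k : ℕ} {P : Set (Tile n)} {T t : Tile n} (hT : T ∈ P)
    (ht : t ∈ s.supertile k T.1) : t.move (dilate (s.factor ^ k) T.2) ∈ s.apply^[k] P := by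
  rw [iterate_apply_eq]
  exact mem_biUnion hT (mem_image_of_mem _ ht)

theorem matrix_pos (hfin : ∀ i, (s.rule i).Finite) {i k : Fin n} {g : Motion}
    (hg : (k, g) ∈ s.rule i) : 0 < s.matrix i k := by
  rw [matrix, Matrix.of_apply, Nat.cast_pos]
  exact (ncard_pos ((hfin i).preimage (Prod.mk_right_injective k).injOn)).2 ⟨g, hg⟩

theorem matrix_nonneg (i k : Fin n) : 0 ≤ s.matrix i k := Nat.cast_nonneg _

theorem exists_mem_rule_of_matrix_pos {i k : Fin n} (h : 0 < s.matrix i k) :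
    ∃ g, (k, g) ∈ s.rule i := by
  rw [matrix, Matrix.of_apply, Nat.cast_pos] at h
  exact nonempty_of_ncard_ne_zero h.ne'

theorem matrix_pow_nonneg (r : ℕ) (i k : Fin n) : 0 ≤ (s.matrix ^ r) i k := by
  induction r generalizing k with
  | zero =>
    rw [pow_zero, Matrix.one_apply]
    split_ifs <;> norm_num
  | succ r ih =>
    rw [pow_succ, Matrix.mul_apply]
    exact Finset.sum_nonneg fun l _ => mul_nonneg (ih l) (matrix_nonneg l k)

theorem matrix_pow_succ_pos {r : ℕ} {i l k : Fin n} (h : 0 < (s.matrix ^ r) i l)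
    (h' : 0 < s.matrix l k) : 0 < (s.matrix ^ (r + 1)) i k := by
  rw [pow_succ, Matrix.mul_apply]
  exact Finset.sum_pos' (fun l _ => mul_nonneg (matrix_pow_nonneg r i l) (matrix_nonneg l k))
    ⟨l, Finset.mem_univ l, mul_pos h h'⟩

/-- Turns primitivity, a statement about numbers, into an actual tile in a supertile. -/
theorem exists_mem_supertile_of_matrix_pow_pos {r : ℕ} {i k : Fin n}
    (h : 0 < (s.matrix ^ r) i k) : ∃ g, (k, g) ∈ s.supertile r i := by
  induction r generalizing k with
  | zero =>
    rw [pow_zero, Matrix.one_apply] at h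
    obtain rfl : i = k := by
      by_contra hne
      simp [hne] at h
    exact ⟨1, rfl⟩
  | succ r ih =>
    rw [pow_succ, Matrix.mul_apply] at h
    obtain ⟨l, -, hl⟩ := Finset.exists_lt_of_sum_lt
      (f := fun _ => (0 : ℝ)) (by simpa using h)
    have hne : (s.matrix ^ r) i l ≠ 0 ∧ s.matrix l k ≠ 0 := mul_ne_zero_iff.1 hl.ne'
    obtain ⟨g, hg⟩ := ih (lt_of_le_of_ne (matrix_pow_nonneg r i l) hne.1.symm)
    obtain ⟨g', hg'⟩ := exists_mem_rule_of_matrix_pos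
      (lt_of_le_of_ne (matrix_nonneg l k) hne.2.symm)
    rw [add_comm]
    rw [← supertile_one] at hg'
    exact ⟨_, s.move_mem_supertile_add hg hg'⟩

end Substitution

/-! ### Anatomy of the patch σ^(2m)(T_1) -/

section Pythia

open Substitution
open scoped Pointwise

variable {m j : ℕ} (hjm : j < m)

theorem supertile_of_lt {i : Fin m} {k : ℕ} (h : (i : ℕ) + k < m) :
    (pythagoras hjm).supertile k i = {(⟨i + k, h⟩, 1)} := by
  induction k with
  | zero => rfl
  | succ k ih =>
    rw [supertile, Function.iterate_succ_apply']
    change (pythagoras hjm).apply ((pythagoras hjm).supertile k i) = _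
    rw [ih (by omega), apply_singleton,
      rule_of_lt hjm (i := ⟨i + k, by omega⟩) (by simpa [add_assoc] using h), image_singleton,
      dilate_one_right, Tile.move_one]
    rfl

theorem supertile_of_eq {i : Fin m} {k : ℕ} (h : (i : ℕ) + k = m) :
    (pythagoras hjm).supertile k i = {phiTile hjm, psiTile hjm} := by
  obtain ⟨k, rfl⟩ : ∃ l, k = l + 1 := ⟨k - 1, by omega⟩
  rw [add_comm k 1, supertile_add, supertile_of_lt hjm (by omega), Function.iterate_one,
    apply_singleton, rule_of_not_lt hjm (by simp; omega), dilate_one_right]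
  simp [Tile.move_one]

theorem iterate_phiTile {k : ℕ} (h : k < m) :
    (pythagoras hjm).apply^[k] {phiTile hjm} = {(⟨k, h⟩, mirror (-theta hjm) 0)} := by
  rw [iterate_apply_singleton, phiTile, supertile_of_lt hjm (by simpa using h), image_singleton,
    dilate_mirror]
  simp [Tile.move]

/-- The part of the `2m`-fold Pythagoras iterate of the first prototile that fills the far corner
of the enlarged triangle. -/
def cornerPatch : Set (Tile m) :=
  Tile.move (dilate (pythagorasFactor hjm ^ m) (psiTile hjm).2) ''
    (pythagoras hjm).apply^[j] {psiTile hjm}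

/-- T_{j+1} splits after m - j steps; in the remaining j steps its small piece just grows back to
type T_{j+1}. -/
theorem supertile_m_j : (pythagoras hjm).supertile m ⟨j, hjm⟩ =
    {(⟨j, hjm⟩, mirror (-theta hjm) 0)} ∪ (pythagoras hjm).apply^[j] {psiTile hjm} := by
  have h := (pythagoras hjm).supertile_add j (m - j) ⟨j, hjm⟩
  rw [Nat.add_sub_cancel' hjm.le] at h
  rw [h, supertile_of_eq hjm (by simp; omega), insert_eq, iterate_apply_union,
    iterate_phiTile hjm hjm]

/-- φ is a reflection fixing the origin, so φφ = 1 and T_1 reappears in place. The other piece, φ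
followed by ψ, is the first tile of the switched rectangle. -/
theorem iterate_m_phiTile : (pythagoras hjm).apply^[m] {phiTile hjm} =
    {(⟨0, by omega⟩, 1), (⟨j, hjm⟩, rot (Real.pi / 2) (apex hjm))} := by
  rw [iterate_apply_singleton, phiTile, supertile_of_eq hjm (by simp), image_pair, dilate_mirror]
  congr 1
  · simp [Tile.move, phiTile, mirror_mul_mirror, rot_zero_zero]
  congr 1
  simp only [Tile.move, psiTile, mirror_mul_mirror, exp_neg_theta, apex]
  congr 2
  · ring
  · simp
    ring

theorem iterate_m_psiTile : (pythagoras hjm).apply^[m] {psiTile hjm} =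
    {(⟨j, hjm⟩, rot (-(Real.pi / 2)) (-(pythagorasFactor hjm : ℂ) ^ m))} ∪ cornerPatch hjm := by
  rw [iterate_apply_singleton, cornerPatch, show (psiTile hjm).1 = ⟨j, hjm⟩ from rfl,
    supertile_m_j, image_union, image_singleton]
  congr 2
  simp only [Tile.move, psiTile]
  rw [dilate_mirror, mirror_mul_mirror]
  congr 2
  · ring
  · simp [pythagoras]

theorem supertile_two_m : (pythagoras hjm).supertile (2 * m) ⟨0, by omega⟩ =
    (pythagoras hjm).apply^[m] {phiTile hjm} ∪ (pythagoras hjm).apply^[m] {psiTile hjm} := by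
  rw [two_mul, supertile_add, supertile_of_eq hjm (by simp), insert_eq, iterate_apply_union]

theorem packs_phiTile_psiTile :
    (pythagoras hjm).Packs ({phiTile hjm} ∪ {psiTile hjm}) := by
  rw [← insert_eq]
  exact pairwise_pair.2 fun _ => ⟨disjoint_interior_phiTile_psiTile hjm,
    (disjoint_interior_phiTile_psiTile hjm).symm⟩

theorem phiTile_ne_psiTile (hj : 1 ≤ j) : phiTile hjm ≠ psiTile hjm := by
  intro h
  have := congrArg (fun T => (T.1 : ℕ)) h
  simp [phiTile, psiTile] at this
  omega

/-- Each old tile and the corner patch descend from different pieces of one dissection: the first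
old tile from φ in the first split, the second from φ in the split inside ψ, while the corner
descends from ψ both times. -/
theorem disjoint_cornerPatch_oldPair (hj : 1 ≤ j) :
    Disjoint (cornerPatch hjm) (oldPair hjm) := by
  have hs := pythagoras_isPacking hjm
  have hdisj : Disjoint ({phiTile hjm} : Set (Tile m)) {psiTile hjm} :=
    disjoint_singleton.2 (phiTile_ne_psiTile hjm hj)
  rw [Set.disjoint_right]
  rintro _ (rfl | rfl) hmem
  · have h := hs.disjoint_iterate m (packs_phiTile_psiTile hjm) hdisj
    rw [iterate_m_phiTile, iterate_m_psiTile] at h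
    exact Set.disjoint_left.1 h (Or.inr rfl) (Or.inr hmem)
  · have h := hs.disjoint_iterate j (packs_phiTile_psiTile hjm) hdisj
    rw [iterate_phiTile hjm hjm] at h
    have h' := (disjoint_image_iff (Tile.move_injective
      (dilate (pythagorasFactor hjm ^ m) (psiTile hjm).2))).2 h
    refine Set.disjoint_left.1 h' ?_ hmem
    rw [image_singleton, mem_singleton_iff]
    simp only [Tile.move, psiTile]
    rw [dilate_mirror, mirror_mul_mirror]
    congr 2
    · ring
    · simp

theorem oldPair_subset :
    oldPair hjm ⊆ (pythagoras hjm).supertile (2 * m) ⟨0, by omega⟩ := by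
  rw [supertile_two_m, iterate_m_phiTile, iterate_m_psiTile]
  rintro _ (rfl | rfl)
  · simp
  · simp

theorem cornerPatch_subset :
    cornerPatch hjm ⊆ (pythagoras hjm).supertile (2 * m) ⟨0, by omega⟩ := by
  rw [supertile_two_m, iterate_m_psiTile]
  exact fun T hT => Or.inr (Or.inr hT)

theorem first_mem : ((⟨0, by omega⟩, 1) : Tile m) ∈
    (pythagoras hjm).supertile (2 * m) ⟨0, by omega⟩ := by
  rw [supertile_two_m, iterate_m_phiTile]
  simp

/-- The image of the first prototile under the Pythia substitution. -/
def pythiaPatch : Set (Tile m) :=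
  ((pythagoras hjm).supertile (2 * m) ⟨0, by omega⟩ \ oldPair hjm) ∪ newPair hjm

theorem pythia_rule (i : Fin m) :
    (pythia hjm).rule i = (pythagoras hjm).apply^[i] (pythiaPatch hjm) := rfl

theorem first_mem_pythiaPatch (hj : 1 ≤ j) :
    ((⟨0, by omega⟩, 1) : Tile m) ∈ pythiaPatch hjm := by
  refine Or.inl ⟨first_mem hjm, ?_⟩
  rintro (h | h) <;>
  · have := congrArg (fun T : Tile m => (T.1 : ℕ)) h
    simp at this
    omega

theorem cornerPatch_subset_pythiaPatch (hj : 1 ≤ j) : cornerPatch hjm ⊆ pythiaPatch hjm :=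
  fun _ hT => Or.inl ⟨cornerPatch_subset hjm hT,
    Set.disjoint_left.1 (disjoint_cornerPatch_oldPair hjm hj) hT⟩

/-- The rectangle in which the diagonal is switched. -/
def switchRectangle : Set ℂ :=
  {z | -pythagorasFactor hjm ^ m ≤ z.re ∧ z.re ≤ -shortLeg hjm ∧ 0 ≤ z.im ∧ z.im ≤ longLeg hjm}

theorem convex_switchRectangle : Convex ℝ (switchRectangle hjm) := by
  exact (convex_halfSpace_re_ge _).inter ((convex_halfSpace_re_le _).inter
    ((convex_halfSpace_im_ge _).inter (convex_halfSpace_im_le _)))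

theorem vertex_eq : (pythagorasFactor hjm : ℂ) ^ j * apex hjm =
    -(longLeg hjm : ℂ) + (pythagorasFactor hjm ^ m - shortLeg hjm : ℂ) * Complex.I := by
  have h1 := congrArg (fun x : ℝ => (x : ℂ)) (longLeg_eq hjm)
  have h2 := congrArg (fun x : ℝ => (x : ℂ)) (factor_pow_j_mul_longLeg hjm)
  push_cast at h1 h2
  rw [apex]
  linear_combination h1 + Complex.I * h2

theorem support_j (g : Motion) : (pythagoras hjm).support (⟨j, hjm⟩, g) = convexHull ℝ
    {g 0, g (-(longLeg hjm : ℂ)), g (-(longLeg hjm : ℂ) +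
      (pythagorasFactor hjm ^ m - shortLeg hjm : ℂ) * Complex.I)} := by
  have h1 := congrArg (fun x : ℝ => (x : ℂ)) (longLeg_eq hjm)
  push_cast at h1
  rw [support_eq, vertex_eq, ← h1]

end Pythia

/-! ### The Pythia substitution is a packing with area eigenvector -/

section PythiaPacking

open Substitution
open scoped Pointwise

variable {m j : ℕ} (hjm : j < m)

theorem support_oldPair_left :
    (pythagoras hjm).support (⟨j, hjm⟩, rot (Real.pi / 2) (apex hjm)) = convexHull ℝ
      {-(shortLeg hjm : ℂ) + longLeg hjm * Complex.I, -(shortLeg hjm : ℂ),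
        -(pythagorasFactor hjm : ℂ) ^ m} := by
  rw [support_j]
  congr 2
  · simp [rot_apply, apex]
  congr 1
  · simp only [rot_apply, exp_half_pi, apex]
    ring
  congr 1
  simp only [rot_apply, exp_half_pi, apex]
  linear_combination ((pythagorasFactor hjm : ℂ) ^ m - shortLeg hjm) * Complex.I_sq

theorem support_oldPair_right :
    (pythagoras hjm).support
      (⟨j, hjm⟩, rot (-(Real.pi / 2)) (-(pythagorasFactor hjm : ℂ) ^ m)) = convexHull ℝ
      {-(pythagorasFactor hjm : ℂ) ^ m, -(pythagorasFactor hjm : ℂ) ^ m + longLeg hjm * Complex.I,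
        -(shortLeg hjm : ℂ) + longLeg hjm * Complex.I} := by
  rw [support_j]
  congr 2
  · simp [rot_apply]
  congr 1
  · simp only [rot_apply, exp_neg_half_pi]
    ring
  congr 1
  simp only [rot_apply, exp_neg_half_pi]
  linear_combination (shortLeg hjm - (pythagorasFactor hjm : ℂ) ^ m) * Complex.I_sq

theorem support_newPair_left :
    (pythagoras hjm).support (⟨j, hjm⟩, mirror (Real.pi / 2)
      (-(pythagorasFactor hjm : ℂ) ^ m + (longLeg hjm : ℂ) * Complex.I)) = convexHull ℝ
      {-(pythagorasFactor hjm : ℂ) ^ m + longLeg hjm * Complex.I, -(pythagorasFactor hjm : ℂ) ^ m,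
        -(shortLeg hjm : ℂ)} := by
  rw [support_j]
  congr 2
  · simp [mirror_apply]
  congr 1
  · simp only [mirror_apply, exp_half_pi, map_neg, Complex.conj_ofReal]
    ring
  congr 1
  simp only [mirror_apply, exp_half_pi, map_neg, map_add, map_sub, map_mul, map_pow,
    Complex.conj_ofReal, Complex.conj_I]
  linear_combination (shortLeg hjm - (pythagorasFactor hjm : ℂ) ^ m) * Complex.I_sq

theorem support_newPair_right :
    (pythagoras hjm).support
      (⟨j, hjm⟩, mirror (-(Real.pi / 2)) (-(shortLeg hjm : ℂ))) = convexHull ℝ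
      {-(shortLeg hjm : ℂ), -(shortLeg hjm : ℂ) + longLeg hjm * Complex.I,
        -(pythagorasFactor hjm : ℂ) ^ m + longLeg hjm * Complex.I} := by
  rw [support_j]
  congr 2
  · simp [mirror_apply]
  congr 1
  · simp only [mirror_apply, exp_neg_half_pi, map_neg, Complex.conj_ofReal]
    ring
  congr 1
  simp only [mirror_apply, exp_neg_half_pi, map_neg, map_add, map_sub, map_mul, map_pow,
    Complex.conj_ofReal, Complex.conj_I]
  linear_combination ((pythagorasFactor hjm : ℂ) ^ m - shortLeg hjm) * Complex.I_sq

theorem shortLeg_lt_factor_pow : shortLeg hjm < pythagorasFactor hjm ^ m :=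
  (shortLeg_lt_one hjm).trans (one_lt_pow₀ (one_lt_factor hjm) (by omega))

theorem support_newPair_subset {T : Tile m} (hT : T ∈ newPair hjm) :
    (pythagoras hjm).support T ⊆ switchRectangle hjm := by
  have hb := longLeg_pos hjm
  have ha := shortLeg_lt_factor_pow hjm
  obtain rfl | rfl := hT
  · rw [support_newPair_left]
    refine convexHull_min ?_ (convex_switchRectangle hjm)
    rintro z (rfl | rfl | rfl) <;>
    simp [switchRectangle, ← Complex.ofReal_pow, hb.le, ha.le]
  · rw [support_newPair_right]
    refine convexHull_min ?_ (convex_switchRectangle hjm)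
    rintro z (rfl | rfl | rfl) <;>
    simp [switchRectangle, ← Complex.ofReal_pow, hb.le, ha.le]

theorem switchRectangle_subset {z : ℂ} (hz : z ∈ switchRectangle hjm) :
    ∃ T ∈ oldPair hjm, z ∈ (pythagoras hjm).support T := by
  have hb := longLeg_pos hjm
  have ha := sub_pos.2 (shortLeg_lt_factor_pow hjm)
  obtain ⟨h1, h2, h3, h4⟩ := hz
  set w := pythagorasFactor hjm ^ m - shortLeg hjm with hw
  -- `p` and `q` are coordinates normalising the rectangle to the unit square; the old diagonal is
  -- `p = q`, and comparing them selects the triangle.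
  set p := (z.re + pythagorasFactor hjm ^ m) / w with hp
  set q := z.im / longLeg hjm with hq
  have hp0 : 0 ≤ p := div_nonneg (by linarith) ha.le
  have hp1 : p ≤ 1 := (div_le_one ha).2 (by linarith)
  have hq0 : 0 ≤ q := div_nonneg h3 hb.le
  have hq1 : q ≤ 1 := (div_le_one hb).2 h4
  have hpw : p * w = z.re + pythagorasFactor hjm ^ m := div_mul_cancel₀ _ ha.ne'
  have hqb : q * longLeg hjm = z.im := div_mul_cancel₀ _ hb.ne'
  obtain hpq | hpq := le_total q p
  · refine ⟨_, Or.inl rfl, ?_⟩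
    rw [support_oldPair_left]
    have h := mem_convexHull_triple (x := -(shortLeg hjm : ℂ) + longLeg hjm * Complex.I)
      (y := -(shortLeg hjm : ℂ)) (z := -(pythagorasFactor hjm : ℂ) ^ m) hq0
      (sub_nonneg.2 hpq) (sub_nonneg.2 hp1) (by ring)
    convert h using 1
    apply Complex.ext
    · simp [← Complex.ofReal_pow]
      linear_combination -hpw + p * hw
    · simp [← Complex.ofReal_pow, hqb]
  · refine ⟨_, Or.inr rfl, ?_⟩
    rw [support_oldPair_right]
    have h := mem_convexHull_triple (x := -(pythagorasFactor hjm : ℂ) ^ m)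
      (y := -(pythagorasFactor hjm : ℂ) ^ m + longLeg hjm * Complex.I)
      (z := -(shortLeg hjm : ℂ) + longLeg hjm * Complex.I)
      (sub_nonneg.2 hq1) (sub_nonneg.2 hpq) hp0 (by ring)
    convert h using 1
    apply Complex.ext
    · simp [← Complex.ofReal_pow]
      linear_combination -hpw + p * hw
    · simp [← Complex.ofReal_pow]
      linear_combination -hqb

theorem disjoint_interior_newPair :
    Disjoint (interior ((pythagoras hjm).support (⟨j, hjm⟩, mirror (Real.pi / 2)
        (-(pythagorasFactor hjm : ℂ) ^ m + (longLeg hjm : ℂ) * Complex.I))))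
      (interior ((pythagoras hjm).support
        (⟨j, hjm⟩, mirror (-(Real.pi / 2)) (-(shortLeg hjm : ℂ))))) := by
  have hb := longLeg_pos hjm
  have ha := sub_pos.2 (shortLeg_lt_factor_pow hjm)
  have hab := mul_pos hb ha
  rw [support_newPair_left, support_newPair_right]
  -- The separating line is the new diagonal, through -a and -λ^m + ib.
  refine disjoint_interior_convexHull (α := longLeg hjm)
    (β := pythagorasFactor hjm ^ m - shortLeg hjm) (c := -(longLeg hjm * shortLeg hjm))
    (by positivity) ?_ ?_
  · rintro z (rfl | rfl | rfl) <;> simp [← Complex.ofReal_pow] <;> linarith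
  · rintro z (rfl | rfl | rfl) <;> simp [← Complex.ofReal_pow] <;> linarith

/-- The new tiles lie in the rectangle, which the old tiles cover, so an overlap with a remaining
tile would give an overlap inside the Pythagoras packing. -/
theorem disjoint_interior_of_mem_newPair {T T' : Tile m}
    (hT : T ∈ (pythagoras hjm).supertile (2 * m) ⟨0, by omega⟩ \ oldPair hjm)
    (hT' : T' ∈ newPair hjm) :
    Disjoint (interior ((pythagoras hjm).support T))
      (interior ((pythagoras hjm).support T')) := by
  have hs := pythagoras_isPacking hjm
  rw [Set.disjoint_left]
  intro z hz hz'
  obtain ⟨U, hU, hzU⟩ := switchRectangle_subset hjm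
    (support_newPair_subset hjm hT' (interior_subset hz'))
  obtain ⟨w, hw, hwU⟩ := hs.inter_interior_nonempty isOpen_interior ⟨z, hzU, hz⟩
  exact Set.disjoint_left.1 (hs.packs_supertile _ _ hT.1 (oldPair_subset hjm hU)
    fun he => hT.2 (he ▸ hU)) hw hwU

theorem packs_pythiaPatch : (pythagoras hjm).Packs (pythiaPatch hjm) := by
  have hnew := disjoint_interior_newPair hjm
  rintro T (hT | hT) T' (hT' | hT') hne
  · exact (pythagoras_isPacking hjm).packs_supertile _ _ hT.1 hT'.1 hne
  · exact disjoint_interior_of_mem_newPair hjm hT hT'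
  · exact (disjoint_interior_of_mem_newPair hjm hT' hT).symm
  · obtain rfl | rfl := hT <;> obtain rfl | rfl := hT'
    · exact absurd rfl hne
    · exact hnew
    · exact hnew.symm
    · exact absurd rfl hne

theorem finite_pythiaPatch : (pythiaPatch hjm).Finite :=
  ((pythagoras_isPacking hjm).finite_supertile _ _).sdiff.union (toFinite {_, _})

theorem support_pythiaPatch_subset {T : Tile m} (hT : T ∈ pythiaPatch hjm) :
    (pythagoras hjm).support T ⊆
      pythagorasFactor hjm ^ (2 * m) • triangle hjm ⟨0, by omega⟩ := by
  have hs := pythagoras_isPacking hjm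
  obtain hT | hT := hT
  · exact hs.support_subset_of_mem_supertile hT.1
  · intro z hz
    obtain ⟨U, hU, hzU⟩ := switchRectangle_subset hjm (support_newPair_subset hjm hT hz)
    exact hs.support_subset_of_mem_supertile (oldPair_subset hjm hU) hzU

theorem pythia_isPacking : (pythia hjm).IsPacking where
  factor_pos := pow_pos (factor_pos hjm) _
  convex := (pythagoras_isPacking hjm).convex
  compact := (pythagoras_isPacking hjm).compact
  interior_nonempty := triangle_interior_nonempty hjm
  rule_finite i := (pythagoras_isPacking hjm).finite_iterate (finite_pythiaPatch hjm) i
  rule_packs i := (pythagoras_isPacking hjm).packs_iterate (packs_pythiaPatch hjm) i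
  rule_subset i T hT := by
    obtain ⟨U, hU, hTU⟩ := (pythagoras_isPacking hjm).exists_support_subset_of_mem_iterate hT
    refine hTU.trans ((smul_set_mono (support_pythiaPatch_subset hjm hU)).trans ?_)
    change pythagorasFactor hjm ^ (i : ℕ) • pythagorasFactor hjm ^ (2 * m) • _ ⊆
      pythagorasFactor hjm ^ (2 * m) • triangle hjm i
    rw [smul_comm, smul_triangle, triangle_eq]
    simp

/-- The areas of the prototiles, up to a common factor. -/
noncomputable def weight (i : Fin m) : ℝ := (pythagorasFactor hjm ^ 2) ^ (i : ℕ)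

theorem one_le_weight (i : Fin m) : 1 ≤ weight hjm i :=
  one_le_pow₀ (one_le_pow₀ (one_lt_factor hjm).le)

/-- At the largest prototile this is the defining equation 1 + λ^(2j) = λ^(2m). -/
theorem finsum_weight_pythagoras (hj : 1 ≤ j) (i : Fin m) :
    ∑ᶠ T ∈ (pythagoras hjm).rule i, weight hjm T.1 =
      pythagorasFactor hjm ^ 2 * weight hjm i := by
  by_cases h : (i : ℕ) + 1 < m
  · rw [rule_of_lt hjm h, finsum_mem_singleton, weight, weight, pow_succ']
  · rw [rule_of_not_lt hjm h, finsum_mem_pair (phiTile_ne_psiTile hjm hj), weight, weight, weight,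
      ← pow_succ', show (i : ℕ) + 1 = m by omega, ← pow_mul, ← pow_mul, ← pow_mul,
      (factor_spec hjm).2]
    simp [phiTile, psiTile, add_comm]

theorem oldPair_ne : ((⟨j, hjm⟩, rot (Real.pi / 2) (apex hjm)) : Tile m) ≠
    (⟨j, hjm⟩, rot (-(Real.pi / 2)) (-(pythagorasFactor hjm : ℂ) ^ m)) := by
  intro h
  have h1 := congrArg (fun T : Tile m => T.2.linearIsometryEquiv 1) h
  simp only [linear_rot, exp_half_pi, exp_neg_half_pi, mul_one] at h1
  have h2 := congrArg Complex.im h1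
  norm_num at h2

theorem newPair_ne : ((⟨j, hjm⟩, mirror (Real.pi / 2)
      (-(pythagorasFactor hjm : ℂ) ^ m + (longLeg hjm : ℂ) * Complex.I)) : Tile m) ≠
    (⟨j, hjm⟩, mirror (-(Real.pi / 2)) (-(shortLeg hjm : ℂ))) := by
  intro h
  have h1 := congrArg (fun T : Tile m => T.2.linearIsometryEquiv 1) h
  simp only [linear_mirror, exp_half_pi, exp_neg_half_pi, mul_one, map_one] at h1
  have h2 := congrArg Complex.im h1
  norm_num at h2

/-- Switching the diagonal changes the motions of two tiles but not their types, hence not the total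
weight. -/
theorem finsum_weight_pythiaPatch (hj : 1 ≤ j) :
    ∑ᶠ T ∈ pythiaPatch hjm, weight hjm T.1 = (pythagorasFactor hjm ^ 2) ^ (2 * m) := by
  have hs := pythagoras_isPacking hjm
  have hfin := hs.finite_supertile (2 * m) ⟨0, by omega⟩
  have hdisj : Disjoint ((pythagoras hjm).supertile (2 * m) ⟨0, by omega⟩ \ oldPair hjm)
      (newPair hjm) := by
    rw [Set.disjoint_left]
    intro T hT hT'
    obtain ⟨z, hz⟩ := hs.support_interior_nonempty T
    exact Set.disjoint_left.1 (disjoint_interior_of_mem_newPair hjm hT hT') hz hz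
  have h1 := hs.finsum_weight_supertile (finsum_weight_pythagoras hjm hj) (2 * m) ⟨0, by omega⟩
  rw [← finsum_mem_add_sdiff (oldPair_subset hjm) hfin] at h1
  rw [pythiaPatch, finsum_mem_union hdisj hfin.sdiff (toFinite {_, _}), add_comm]
  rw [oldPair, finsum_mem_pair (oldPair_ne hjm)] at h1
  rw [oldPair, newPair, finsum_mem_pair (newPair_ne hjm), h1]
  simp [weight]

theorem finsum_weight_pythia (hj : 1 ≤ j) (i : Fin m) :
    ∑ᶠ T ∈ (pythia hjm).rule i, weight hjm T.1 =
      (pythagorasFactor hjm ^ 2) ^ (2 * m) * weight hjm i := by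
  rw [pythia_rule, (pythagoras_isPacking hjm).finsum_weight_iterate
    (finsum_weight_pythagoras hjm hj) (packs_pythiaPatch hjm) (finite_pythiaPatch hjm),
    finsum_weight_pythiaPatch hjm hj, weight, mul_comm]

end PythiaPacking

/-! ### Primitivity and interfering tiles -/

section Pythia

open Substitution

variable {m j : ℕ} (hjm : j < m)

/-- The unmoved T_1 survives in the patch for T_1, and i Pythagoras steps enlarge it to the unmoved
T_{i+1}. -/
theorem self_mem_rule (hj : 1 ≤ j) (i : Fin m) : (i, 1) ∈ (pythia hjm).rule i := by
  have h := move_mem_iterate (s := pythagoras hjm) (k := i) (t := (i, 1))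
    (first_mem_pythiaPatch hjm hj) (by rw [supertile_of_lt hjm (by simp)]; simp)
  rw [dilate_one_right, Tile.move_one] at h
  exact h

theorem newPair_left_mem : ((⟨j, hjm⟩, mirror (Real.pi / 2)
    (-(pythagorasFactor hjm : ℂ) ^ m + (longLeg hjm : ℂ) * Complex.I)) : Tile m) ∈
      pythiaPatch hjm :=
  Or.inr (Or.inl rfl)

theorem mem_supertile_wrap {i : Fin m} (h : m ≤ i + j) :
    (⟨i + j - m, by omega⟩, mirror (-theta hjm) 0) ∈ (pythagoras hjm).supertile i ⟨j, hjm⟩ := by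
  have h1 := (pythagoras hjm).supertile_add (i + j - m) (m - j) ⟨j, hjm⟩
  rw [show (i : ℕ) + j - m + (m - j) = i by omega, 
    supertile_of_eq hjm (i := ⟨j, hjm⟩) (k := m - j) (by simp; omega), insert_eq,
    iterate_apply_union, iterate_phiTile hjm (by omega)] at h1
  rw [h1]
  exact Or.inl rfl

theorem matrix_pos_self (hj : 1 ≤ j) (i : Fin m) : 0 < (pythia hjm).matrix i i :=
  matrix_pos (pythia_isPacking hjm).rule_finite (self_mem_rule hjm hj i)

/-- Follow the new tile of index `j` through `i` Pythagoras steps: its index grows to i + j, and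
when it passes the end, the small piece of the split restarts at 0. -/
theorem matrix_pos_step (i : Fin m) :
    0 < (pythia hjm).matrix i ⟨(i + j) % m, Nat.mod_lt _ (by omega)⟩ := by
  obtain ⟨g, hg⟩ : ∃ g : Motion, ((⟨(i + j) % m, Nat.mod_lt _ (by omega)⟩, g) : Tile m) ∈
      (pythagoras hjm).supertile i ⟨j, hjm⟩ := by
    by_cases h : (i : ℕ) + j < m
    · refine ⟨1, ?_⟩
      rw [supertile_of_lt hjm (by simpa [add_comm] using h), mem_singleton_iff]
      congr 1
      apply Fin.ext
      change ((i : ℕ) + j) % m = j + i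
      rw [Nat.mod_eq_of_lt h, add_comm]
    · refine ⟨mirror (-theta hjm) 0, ?_⟩
      have h' : ((i : ℕ) + j) % m = i + j - m := by
        rw [Nat.mod_eq_sub_mod (by omega), Nat.mod_eq_of_lt (by omega)]
      simp only [h']
      exact mem_supertile_wrap hjm (by omega)
  exact matrix_pos (pythia_isPacking hjm).rule_finite
    (move_mem_iterate (s := pythagoras hjm) (newPair_left_mem hjm) hg)

/-- Shift the type by `j` in `r` of the steps and keep it in the others, using the positive
diagonal. -/
theorem matrix_pow_pos (hj : 1 ≤ j) (k r : ℕ) (hr : r ≤ k) (i : Fin m) :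
    0 < ((pythia hjm).matrix ^ k) i ⟨(i + r * j) % m, Nat.mod_lt _ (by omega)⟩ := by
  induction k generalizing r with
  | zero =>
    obtain rfl : r = 0 := by omega
    simp [Nat.mod_eq_of_lt i.2]
  | succ k ih =>
    obtain hr' | rfl : r ≤ k ∨ r = k + 1 := by omega
    · exact matrix_pow_succ_pos (ih r hr') (matrix_pos_self hjm hj _)
    · have h := matrix_pow_succ_pos (ih k le_rfl) (matrix_pos_step hjm _)
      simp only [Nat.mod_add_mod] at h
      rwa [show (i : ℕ) + (k + 1) * j = i + k * j + j by ring]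

theorem pythia_isPrimitive (hj : 1 ≤ j) (hmj : Nat.Coprime m j) :
    (pythia hjm).matrix.IsPrimitive where
  nonneg := matrix_nonneg
  exists_pos_pow := by
    refine ⟨m, by omega, fun i k => ?_⟩
    -- As `j` is invertible modulo `m`, the types i + rj with r < m run through all residues.
    have hinj : Function.Injective fun r : Fin m =>
        (⟨(i + r * j) % m, Nat.mod_lt _ (by omega)⟩ : Fin m) := by
      intro r r' h
      have h1 : (i + r * j : ℕ) ≡ i + r' * j [MOD m] := congrArg Fin.val h
      have h2 := Nat.ModEq.cancel_right_of_coprime hmj (Nat.ModEq.add_left_cancel' _ h1)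
      exact Fin.ext (Nat.ModEq.eq_of_lt_of_lt h2 r.2 r'.2)
    obtain ⟨r, rfl⟩ := Finite.surjective_of_injective hinj k
    exact matrix_pow_pos hjm hj m r r.2.le i

/-- The second-order supertile of a suitable prototile contains two mirrored tiles whose
directions differ by a rotation of infinite order. -/
theorem exists_interfere (hj : 1 ≤ j) {p : ℕ} (hp : 0 < p) :
    ∃ i, ∃ T ∈ (pythia hjm).supertile 2 i, ∃ T' ∈ (pythia hjm).supertile 2 i,
      Interfere p T T' := by
  -- m - j is the number of Pythagoras steps after which T_{j+1} splits. It also completes the j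
  -- steps already made inside the corner patch to m steps.
  set i : Fin m := ⟨m - j, by omega⟩ with hi
  obtain ⟨g, hg, hglin⟩ : ∃ g : Motion, (⟨j, hjm⟩, g) ∈ (pythia hjm).rule i ∧
      ∀ z, g.linearIsometryEquiv z =
        Complex.exp ((-theta hjm : ℝ) * Complex.I) * (starRingEnd ℂ) z := by
    have h1 : ((⟨j, hjm⟩, mirror (-theta hjm) 0) : Tile m) ∈
        (pythagoras hjm).supertile m ⟨j, hjm⟩ := by
      rw [supertile_m_j]
      exact Or.inl rfl
    have hadd := (pythagoras hjm).supertile_add (m - j) j ⟨j, hjm⟩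
    rw [Nat.sub_add_cancel hjm.le] at hadd
    have h2 := (pythagoras hjm).iterate_apply_mono (m - j)
      (cornerPatch_subset_pythiaPatch hjm hj)
    rw [cornerPatch, iterate_apply_singleton, iterate_apply_move, iterate_apply_move,
      show (psiTile hjm).1 = ⟨j, hjm⟩ from rfl, ← hadd] at h2
    refine ⟨_, h2 (mem_image_of_mem _ (mem_image_of_mem _ h1)), fun z => ?_⟩
    simp only [Tile.move, linear_mul, linear_dilate, psiTile, linear_mirror, map_mul,
      Complex.conj_conj]
    -- The tile is reached by ψ, ψ, φ in succession; the linear parts of the two ψ cancel, so only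
    -- that of φ remains.
    have hE : ∀ φ : ℝ, Complex.exp (φ * Complex.I) *
        (starRingEnd ℂ) (Complex.exp (φ * Complex.I)) = 1 := fun φ => by
      rw [Complex.mul_conj, Complex.normSq_eq_norm_sq, Complex.norm_exp_ofReal_mul_I]
      simp
    rw [← mul_assoc, hE, one_mul]
  obtain ⟨h, hh, hhlin⟩ : ∃ h : Motion,
      ((⟨0, by omega⟩, h) : Tile m) ∈ (pythia hjm).rule i ∧
      ∀ z, h.linearIsometryEquiv z =
        Complex.I * Complex.exp (theta hjm * Complex.I) * z := by
    have h1 : phiTile hjm ∈ (pythagoras hjm).supertile (m - j) ⟨j, hjm⟩ := by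
      rw [supertile_of_eq hjm (by simp; omega)]
      exact Or.inl rfl
    refine ⟨_, move_mem_iterate (s := pythagoras hjm) (newPair_left_mem hjm) h1, fun z => ?_⟩
    simp only [linear_mul, linear_dilate, phiTile, linear_mirror, exp_half_pi, exp_neg_theta,
      exp_theta, map_mul, map_sub, Complex.conj_ofReal, Complex.conj_I, Complex.conj_conj]
    ring
  rw [← supertile_one] at hg hh
  -- One more substitution equalises type and handedness: the mirrored T_{j+1} is kept as it is, and
  -- in the rotated T_1 the mirrored new tile is chosen. The directions become exp(-iθ) and
  -- -exp(iθ).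
  have hT := (pythia hjm).move_mem_supertile_add hg (k := 1) (T' := (⟨j, hjm⟩, 1))
    (by rw [supertile_one]; exact self_mem_rule hjm hj _)
  have hT' := (pythia hjm).move_mem_supertile_add hh (k := 1)
    (by rw [supertile_one]; exact newPair_left_mem hjm)
  refine ⟨i, _, hT, _, hT', rfl, ?_, Or.inr ⟨fun z => ?_, fun z => ?_⟩⟩
  · simp only [Tile.dir, Tile.move, linear_mul, linear_dilate, hglin, hhlin,
      linear_mirror, exp_half_pi, map_one, mul_one]
    rw [Complex.ofReal_neg, neg_mul, Complex.exp_neg]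
    intro he
    -- Squaring removes the sign (-1)^p, so equality would give E^(-2p) = E^(2p), that is, E^(4p) =
    -- 1.
    refine exp_theta_pow_ne_one hj hjm (n := 4 * p) (by omega) ?_
    have h0 := Complex.exp_ne_zero (theta hjm * Complex.I)
    generalize Complex.exp (theta hjm * Complex.I) = E at he h0
    have h1 : (E⁻¹ ^ p) ^ 2 = (E ^ p) ^ 2 := by
      rw [he, mul_right_comm, Complex.I_mul_I, neg_one_mul, neg_pow, mul_pow, ← pow_mul,
        mul_comm p 2, pow_mul]
      simp
    have h2 : E⁻¹ ^ p * E ^ p = 1 := by rw [← mul_pow, inv_mul_cancel₀ h0, one_pow]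
    calc E ^ (4 * p) = (E ^ p) ^ 2 * (E ^ p) ^ 2 := by ring
      _ = (E⁻¹ ^ p * E ^ p) ^ 2 := by rw [← h1]; nth_rw 1 [h1]; rw [mul_pow, h1]
      _ = 1 := by rw [h2, one_pow]
  · simp only [Tile.dir, Tile.move, mul_one, linear_dilate, hglin, map_one]
  · simp only [Tile.dir, Tile.move, linear_mul, linear_dilate, hhlin, linear_mirror, map_one,
      mul_one]
    ring

/-- By primitivity every order-`k` supertile contains a copy of the special prototile, and
interference is invariant under motions. -/
theorem exists_interfere_all (hj : 1 ≤ j) (hmj : Nat.Coprime m j) {p : ℕ} (hp : 0 < p) :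
    ∃ l, ∀ i, ∃ T ∈ (pythia hjm).supertile l i, ∃ T' ∈ (pythia hjm).supertile l i,
      Interfere p T T' := by
  obtain ⟨i₀, T, hT, T', hT', h⟩ := exists_interfere hjm hj hp
  obtain ⟨k, -, hk⟩ := (pythia_isPrimitive hjm hj hmj).exists_pos_pow
  refine ⟨2 + k, fun i => ?_⟩
  obtain ⟨g, hg⟩ := exists_mem_supertile_of_matrix_pow_pos (hk i i₀)
  exact ⟨_, (pythia hjm).move_mem_supertile_add hg hT, _,
    (pythia hjm).move_mem_supertile_add hg hT', h.move _⟩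

end Pythia

end SubstTiling

theorem theorem6p2 (m j : ℕ) (hm : 3 ≤ m) (hj : 1 ≤ j) (hjm : j < m) (hmj : Nat.Coprime m j)
    (𝒯 : Set (SubstTiling.Tile m))
    (h𝒯 : (SubstTiling.pythia hjm).IsSubstitutionTiling 𝒯) :
    (SubstTiling.pythia hjm).HasStatisticalCircularSymmetry 𝒯 := by
  have hs := SubstTiling.pythia_isPacking hjm
  refine hs.hasStatisticalCircularSymmetry (SubstTiling.pythia_isPrimitive hjm hj hmj) ?_ h𝒯
  intro p hp ε hε
  obtain ⟨l, hl⟩ := SubstTiling.exists_interfere_all hjm hj hmj hp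
  exact hs.eventually_norm_weylSum_le (SubstTiling.finsum_weight_pythia hjm hj)
    (pow_pos (pow_pos (SubstTiling.factor_pos hjm) 2) _) (SubstTiling.one_le_weight hjm) hl hε
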